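/- Let $0<\alpha<1$. For $z\in\mathbf C\setminus\,]-\infty,0]$ put $$G_\alpha(z)=\frac1{2i\pi}\int_0^\infty \frac{e^{-e^{-i\pi\alpha}y^\alpha z^{1-\alpha}}-e^{-e^{i\pi\alpha}y^\alpha z^{1-\alpha}}}{z}\,e^{-y}\,dy,$$ where $z^{1-\alpha}$ is the determination of the power function that is analytic on $\mathbf C\setminus\,]-\infty,0]$ and positive on $]0,+\infty[$, and let $\delta=(1-\alpha)\alpha^{\frac{\alpha}{1-\alpha}}$. Then for every $r>0$ the boundary value $$G_\alpha(-r^+)=\lim_{z\to -r,\ \Im z>0}G_\alpha(z)$$ exists and is nonzero, and it has a (unique) polar decomposition $G_\alpha(-r^+)=R(r)e^{-i\pi\theta(r)}$ with $R(r)>0$ and $\theta(r)\in\,]0,1[$, that is, $\theta(r)=-\tfrac1\pi\arg G_\alpha(-r^+)$ with the principal argument. Moreover, there is a constant $a>0$ (depending only on $\alpha$) such that for all $z\in\mathbf C\setminus\,]-\infty,0]$ $$G_\alpha(z)=a\,e^{-\delta z}\exp\left(\int_0^\infty\left[\frac1{z+t}-\frac1{1+t}\right]\theta(t)\,dt\right),$$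 where the integral converges absolutely. -/

import Mathlib

open Filter Topology MeasureTheory

noncomputable section

namespace StableHCM

/-- The function `G_α(z) = (2iπ)⁻¹ ∫₀^∞ (e^{-e^{-iπα} y^α z^{1-α}} - e^{-e^{iπα} y^α z^{1-α}}) / z · e^{-y} dy`,
with the principal determination of `z^{1-α}`; it is used for `0 < α < 1` and `z ∈ ℂ ∖ ]-∞, 0]`. -/
def G (α : ℝ) (z : ℂ) : ℂ :=
  (2 * Complex.I * (Real.pi : ℂ))⁻¹ *
    ∫ y in Set.Ioi (0 : ℝ),
      (Complex.exp (-(Complex.exp (-(Complex.I * (Real.pi : ℂ) * (α : ℂ))) *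
            ((y ^ α : ℝ) : ℂ) * z ^ (1 - (α : ℂ)))) -
        Complex.exp (-(Complex.exp (Complex.I * (Real.pi : ℂ) * (α : ℂ)) *
            ((y ^ α : ℝ) : ℂ) * z ^ (1 - (α : ℂ))))) / z *
        Complex.exp (-(y : ℂ))

/-- The filter `z → -r`, `Im z > 0`. -/
def nhdsAbove (r : ℝ) : Filter ℂ := 𝓝[{z : ℂ | 0 < z.im}] (-(r : ℂ))

/-- The boundary value `G_α(-r⁺)`, the limit of `G_α(z)` as `z → -r`, `Im z > 0`. -/
def GPlus (α r : ℝ) : ℂ := limUnder (nhdsAbove r) (G α)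

/-- The angle `θ(r)` in the polar decomposition `G_α(-r⁺) = R(r) e^{-iπθ(r)}`. -/
def theta (α r : ℝ) : ℝ := -(GPlus α r).arg / Real.pi

/-- The constant `δ = (1-α) α^{α/(1-α)}`. -/
def delta (α : ℝ) : ℝ := (1 - α) * α ^ (α / (1 - α))

end StableHCM

end

/-!
In the coordinate `z = e^w` the functions `G_α` and `K(z) = e^{δz} G_α(z)` become entire functions
`logG` and `logK` of `w`, and the closed upper half-plane, cut at the origin, becomes the strip
`0 ≤ Im w ≤ π`. The point of the argument is that `-K` maps the upper half-plane into itself.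

* On the upper side of the negative axis `Im K < 0`, because `Re e^u < e^{|u|}` unless `u > 0`
  (`im_logK_pi_neg`); on the positive axis `K` is real. This already gives the boundary values and
  `θ ∈ ]0,1[`.
* `K` is bounded in the closed upper half-plane outside the unit disc (`exists_norm_logK_le`), and
  `O(|z|^{-α})` near the origin. Both terms of `G_α` are integrals of `e^{z(ζ - ζ^α)}` along rays
  of the Riemann surface of the logarithm, and Cauchy's theorem (`integral_saddleExp_rotate`)
  allows the rays to be deformed. On the positive axis the new contour passes through the saddle
  point of `ζ - ζ^α`, where the value is `-δ`; this gives even `K(x) → 0` as `x → +∞`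
  (`tendsto_logK_ofReal`). On the imaginary axis a contour along which the exponent has a
  nonpositive real part suffices, and on the negative axis absolute values do. The
  Phragmén-Lindelöf principle in the two quadrants extends the bound to the half-plane.
* Since `K` is `O(|z|^c)` at infinity and `O(|z|^{-c})` at the origin with `c < 1`, the
  Phragmén-Lindelöf principle for `exp (-iK)` carries the sign of `Im K` from the real axis into the
  half-plane (`im_logK_neg`). By the Cauchy-Riemann equations `K` is nonincreasing on the positive
  axis, and as it tends to `0` it is positive there (`logK_re_pos`).
* Hence the principal logarithm of `K` is holomorphic in the upper half-plane, with a bounded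
  imaginary part whose boundary values are `0` on the positive and `-πθ` on the negative axis. The
  integral in the statement has the same properties, its imaginary part being a Poisson integral
  of `θ`. A bounded function of this kind is determined by its boundary values at the points other
  than `0` and `∞` (`norm_le_one_of_strip`), so that the two differ by a real constant
  (`exists_log_logK_eq`). The identity theorem extends the resulting formula from the upper
  half-plane to the slit plane.
-/

namespace StableHCM
open Complex Set

/-! ### Rotation of rays on the Riemann surface of the logarithm -/

/-- The function `ζ ↦ e^{z (ζ - ζ^α)}` on the Riemann surface of the logarithm, in the polar
coordinates `ζ = v e^{iu}`, `v ≥ 0`. -/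
noncomputable def saddleExp (α : ℝ) (z : ℂ) (v u : ℝ) : ℂ :=
  exp (z * ((v : ℂ) * exp (u * I) - ((v ^ α : ℝ) : ℂ) * exp ((α * u : ℝ) * I)))

lemma continuous_saddleExp {α : ℝ} (hα : 0 < α) (z : ℂ) :
    Continuous fun p : ℝ × ℝ => saddleExp α z p.1 p.2 := by
  unfold saddleExp
  have : Continuous fun p : ℝ × ℝ => p.1 ^ α :=
    (Real.continuous_rpow_const hα.le).comp continuous_fst
  fun_prop

/-- In the coordinate `w = log ζ` the form `e^{z (ζ - ζ^α)} dζ` is `Φ(w) dw` with `Φ` entire. -/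
lemma exp_mul_saddleExp_eq {α : ℝ} (z : ℂ) {v : ℝ} (hv : 0 < v) (u : ℝ) :
    (v : ℂ) * exp (u * I) * saddleExp α z v u =
      exp ((Real.log v + u * I) +
        z * (exp (Real.log v + u * I) - exp (α * (Real.log v + u * I)))) := by
  have h1 : exp ((Real.log v : ℂ) + u * I) = v * exp (u * I) := by
    rw [exp_add, ← ofReal_exp, Real.exp_log hv]
  have h2 : exp ((α : ℂ) * ((Real.log v : ℂ) + u * I)) =
      ((v ^ α : ℝ) : ℂ) * exp ((α * u : ℝ) * I) := by
    rw [Real.rpow_def_of_pos hv, ofReal_exp, ← exp_add]; push_cast; ring_nf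
  rw [exp_add, h2, h1, saddleExp]

/-- Rotation of the segment `[0, b]` from the angle `u₀` to the angle `u₁` (Cauchy's theorem on a
circular sector of the Riemann surface of the logarithm). -/
theorem integral_saddleExp_rotate {α : ℝ} (hα : 0 < α) (z : ℂ) {b : ℝ} (hb : 0 < b) (u₀ u₁ : ℝ) :
    ∫ v in (0 : ℝ)..b, exp (u₁ * I) * saddleExp α z v u₁ =
      (∫ v in (0 : ℝ)..b, exp (u₀ * I) * saddleExp α z v u₀) +
        ∫ u in u₀..u₁, I * (b * exp (u * I) * saddleExp α z b u) := by
  have hcont := continuous_saddleExp hα z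
  have hray : ∀ u : ℝ, Continuous fun v : ℝ => exp (u * I) * saddleExp α z v u := fun u =>
    continuous_const.mul (hcont.comp (continuous_id.prodMk continuous_const))
  have harc : Continuous fun p : ℝ × ℝ =>
      I * ((p.1 : ℂ) * exp (p.2 * I) * saddleExp α z p.1 p.2) := by
    fun_prop
  obtain ⟨P, hP⟩ : IsExactOn (fun w : ℂ => exp (w + z * (exp w - exp (α * w)))) univ :=
    Differentiable.isExactOn_univ (by fun_prop)
  replace hP : ∀ w, HasDerivAt P (exp (w + z * (exp w - exp (α * w)))) w :=
    fun w => hP w (mem_univ w)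
  have key_ray : ∀ u ε : ℝ, 0 < ε → ε ≤ b →
      ∫ v in ε..b, exp (u * I) * saddleExp α z v u =
        P (Real.log b + u * I) - P (Real.log ε + u * I) := by
    intro u ε hε hεb
    refine intervalIntegral.integral_eq_sub_of_hasDerivAt
      (f := fun v : ℝ => P (Real.log v + u * I)) (fun v hv => ?_) ((hray u).intervalIntegrable _ _)
    rw [uIcc_of_le hεb] at hv
    have hv0 : 0 < v := hε.trans_le hv.1
    have h1 : HasDerivAt (fun v : ℝ => (Real.log v : ℂ) + u * I) ((v⁻¹ : ℝ) : ℂ) v :=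
      (Real.hasDerivAt_log hv0.ne').ofReal_comp.add_const _
    have h2 := (hP (Real.log v + u * I)).comp v h1
    refine h2.congr_deriv ?_
    rw [← exp_mul_saddleExp_eq z hv0]
    push_cast
    field_simp [ofReal_ne_zero.2 hv0.ne']
  have key_arc : ∀ ε : ℝ, 0 < ε →
      ∫ u in u₀..u₁, I * ((ε : ℂ) * exp (u * I) * saddleExp α z ε u) =
        P (Real.log ε + u₁ * I) - P (Real.log ε + u₀ * I) := by
    intro ε hε
    refine intervalIntegral.integral_eq_sub_of_hasDerivAt
      (f := fun u : ℝ => P (Real.log ε + u * I)) (fun u _ => ?_)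
      ((harc.comp (continuous_const.prodMk continuous_id)).intervalIntegrable _ _)
    have h1 : HasDerivAt (fun u : ℝ => (Real.log ε : ℂ) + u * I) I u := by
      simpa using ((hasDerivAt_id u).ofReal_comp.mul_const I).const_add (Real.log ε : ℂ)
    have h2 := (hP (Real.log ε + u * I)).comp u h1
    refine h2.congr_deriv ?_
    rw [← exp_mul_saddleExp_eq z hε, mul_comm]
  -- the difference of the two sides, with the sector truncated at radius `ε`
  set J : ℝ → ℂ := fun ε => (∫ v in ε..b, exp (u₁ * I) * saddleExp α z v u₁) -
    (∫ v in ε..b, exp (u₀ * I) * saddleExp α z v u₀) -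
    (∫ u in u₀..u₁, I * (b * exp (u * I) * saddleExp α z b u)) +
    ∫ u in u₀..u₁, I * ((ε : ℂ) * exp (u * I) * saddleExp α z ε u) with hJ
  have hJ0 : ∀ ε ∈ Ioc 0 b, J ε = 0 := by
    intro ε hε
    simp only [hJ]
    rw [key_ray _ _ hε.1 hε.2, key_ray _ _ hε.1 hε.2, key_arc b hb, key_arc ε hε.1]
    ring
  have hprim : ∀ u : ℝ, Continuous fun ε : ℝ => ∫ v in ε..b, exp (u * I) * saddleExp α z v u := by
    intro u
    simp_rw [intervalIntegral.integral_symm b]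
    exact (intervalIntegral.continuous_primitive (fun a c => (hray u).intervalIntegrable a c) b).neg
  have hJc : Continuous J :=
    (((hprim u₁).sub (hprim u₀)).sub continuous_const).add
      (intervalIntegral.continuous_parametric_intervalIntegral_of_continuous' harc _ _)
  have hlim : Tendsto J (𝓝[>] 0) (𝓝 (J 0)) := hJc.continuousAt.tendsto.mono_left nhdsWithin_le_nhds
  have hev : J =ᶠ[𝓝[>] 0] fun _ => 0 := by
    filter_upwards [Ioc_mem_nhdsGT hb] with ε hε using hJ0 ε hε
  have hzero : J 0 = 0 := tendsto_nhds_unique hlim (tendsto_const_nhds.congr' hev.symm)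
  simp only [hJ, ofReal_zero, zero_mul, mul_zero, intervalIntegral.integral_zero, add_zero] at hzero
  linear_combination hzero

/-! ### A maximum principle in a strip -/

/-- The horizontal strip `0 < Im w < π`, which `exp` maps onto the upper half-plane. -/
def strip : Set ℂ := {w | 0 < w.im ∧ w.im < Real.pi}

lemma isOpen_strip : IsOpen strip :=
  (isOpen_lt continuous_const continuous_im).inter (isOpen_lt continuous_im continuous_const)

lemma convex_strip : Convex ℝ strip :=
  (convex_halfSpace_im_gt 0).inter (convex_halfSpace_im_lt Real.pi)

/-- A bounded holomorphic function on the strip whose modulus is asymptotically at most `1` at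
every finite boundary point has modulus at most `1`; no continuous extension to the boundary is
assumed. -/
theorem norm_le_one_of_strip {f : ℂ → ℂ} (hf : DifferentiableOn ℂ f strip) {C : ℝ}
    (hC : ∀ w ∈ strip, ‖f w‖ ≤ C)
    (hb : ∀ w₀ : ℂ, w₀.im = 0 ∨ w₀.im = Real.pi → ∀ η > 0, ∀ᶠ w in 𝓝[strip] w₀, ‖f w‖ < 1 + η) :
    ∀ w ∈ strip, ‖f w‖ ≤ 1 := by
  -- the barrier is `exp (-ε q)`: `Re q` is positive and grows at both ends of the strip
  set q : ℂ → ℂ := fun w => cosh ((w - (Real.pi / 2 : ℝ) * I) / 2) with hq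
  have hqd : Differentiable ℂ q := by
    intro w; exact (differentiable_cosh _).comp w (by fun_prop)
  have hqre : ∀ w ∈ strip, 0 ≤ (q w).re ∧ |w.re| / 8 ≤ (q w).re := by
    intro w hw
    have h1 : (q w).re = Real.cosh (w.re / 2) * Real.cos ((w.im - Real.pi / 2) / 2) := by
      have : (w - (Real.pi / 2 : ℝ) * I) / 2 =
          (w.re / 2 : ℝ) + ((w.im - Real.pi / 2) / 2 : ℝ) * I := by
        apply Complex.ext <;> simp
      simp only [hq]
      rw [this, cosh_add, cosh_mul_I, sinh_mul_I, ← ofReal_cosh, ← ofReal_cos, ← ofReal_sinh,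
        ← ofReal_sin]
      simp only [add_re, mul_re, ofReal_re, ofReal_im, I_re, I_im, mul_im]
      ring
    have h2 : 1 / 2 ≤ Real.cos ((w.im - Real.pi / 2) / 2) := by
      rw [← Real.cos_pi_div_three, ← Real.cos_abs ((w.im - Real.pi / 2) / 2)]
      have : |(w.im - Real.pi / 2) / 2| ≤ Real.pi / 3 := by
        rw [abs_le]; constructor <;> linarith [hw.1, hw.2, Real.pi_pos]
      exact Real.cos_le_cos_of_nonneg_of_le_pi (abs_nonneg _) (by linarith [Real.pi_pos]) this
    have h3 : |w.re| / 4 ≤ Real.cosh (w.re / 2) := by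
      rw [← Real.cosh_abs, Real.cosh_eq, abs_div]
      have := Real.add_one_le_exp (|w.re| / |2|)
      have := Real.exp_pos (-(|w.re| / |2|))
      have h22 : |(2 : ℝ)| = 2 := by norm_num
      rw [h22] at *
      linarith
    have h4 := Real.cosh_pos (w.re / 2)
    rw [h1]
    constructor
    · positivity
    · have : 0 ≤ |w.re| := abs_nonneg _
      nlinarith
  have hC0 : 0 ≤ C := (norm_nonneg _).trans (hC (Real.pi / 2 * I) (by
    constructor <;> simp <;> linarith [Real.pi_pos]))
  have main : ∀ ε > 0, ∀ η > 0, ∀ w ∈ strip, ‖f w * exp (-(ε : ℝ) * q w)‖ ≤ 1 + η := by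
    intro ε hε η hη
    set F : ℂ → ℂ := fun w => f w * exp (-(ε : ℝ) * q w) with hF
    have hFd : DifferentiableOn ℂ F strip :=
      hf.mul (((hqd.const_mul (-(ε : ℂ))).cexp).differentiableOn)
    have hexp : ∀ w, ‖exp (-(ε : ℝ) * q w)‖ = Real.exp (-ε * (q w).re) := by
      intro w; rw [norm_exp, ← ofReal_neg, re_ofReal_mul]
    have hFle : ∀ w ∈ strip, ‖F w‖ ≤ ‖f w‖ := by
      intro w hw
      simp only [hF]
      rw [norm_mul, hexp]
      refine mul_le_of_le_one_right (norm_nonneg _) (Real.exp_le_one_iff.2 ?_)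
      nlinarith [(hqre w hw).1]
    have hfar : ∃ N : ℝ, ∀ w ∈ strip, N ≤ |w.re| → ‖F w‖ < 1 := by
      have ht : Tendsto (fun x : ℝ => C * Real.exp (-(ε / 8) * x)) atTop (𝓝 (C * 0)) := by
        refine Tendsto.const_mul _ (Real.tendsto_exp_atBot.comp ?_)
        exact tendsto_id.const_mul_atTop_of_neg (by linarith)
      rw [mul_zero] at ht
      obtain ⟨N, hN⟩ := (eventually_atTop.1 (ht.eventually (gt_mem_nhds zero_lt_one)))
      refine ⟨N, fun w hw hNw => ?_⟩
      refine lt_of_le_of_lt ?_ (hN _ hNw)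
      simp only [hF]
      rw [norm_mul, hexp]
      refine mul_le_mul (hC w hw) (Real.exp_le_exp.2 ?_) (Real.exp_pos _).le hC0
      nlinarith [(hqre w hw).2]
    obtain ⟨N, hN⟩ := hfar
    by_contra! hcon
    obtain ⟨w', hw', hbig⟩ := hcon
    -- the set where the modulus is large is compact, as it keeps away from the boundary and from
    -- both ends, so the modulus attains its maximum over the strip
    set T : Set ℂ := {w | w ∈ strip ∧ 1 + η ≤ ‖F w‖} with hT
    have hTcl : IsClosed T := by
      refine isClosed_of_closure_subset fun w₀ hw₀ => ?_
      have hcl : 0 ≤ w₀.im ∧ w₀.im ≤ Real.pi := by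
        have hsub : T ⊆ {w : ℂ | 0 ≤ w.im} ∩ {w : ℂ | w.im ≤ Real.pi} :=
          fun w hw => ⟨hw.1.1.le, hw.1.2.le⟩
        exact closure_minimal hsub ((isClosed_le continuous_const continuous_im).inter
          (isClosed_le continuous_im continuous_const)) hw₀
      have hfreq : ∃ᶠ w in 𝓝[strip] w₀, 1 + η ≤ ‖F w‖ := by
        rw [frequently_nhdsWithin_iff]
        exact (mem_closure_iff_frequently.1 hw₀).mono fun w hw => ⟨hw.2, hw.1⟩
      by_cases hs : w₀ ∈ strip
      · refine ⟨hs, ?_⟩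
        by_contra! hlt
        have hc : ContinuousWithinAt (fun w => ‖F w‖) strip w₀ := (hFd.continuousOn w₀ hs).norm
        exact hfreq ((hc.eventually (gt_mem_nhds hlt)).mono fun w hw => not_le.2 hw)
      · exfalso
        have hbd : w₀.im = 0 ∨ w₀.im = Real.pi := by
          by_contra! h
          exact hs ⟨lt_of_le_of_ne hcl.1 (Ne.symm h.1), lt_of_le_of_ne hcl.2 h.2⟩
        refine hfreq ?_
        filter_upwards [hb w₀ hbd η hη, self_mem_nhdsWithin] with w hw hws
        exact not_le.2 ((hFle w hws).trans_lt hw)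
    have hTc : IsCompact T := by
      refine Metric.isCompact_of_isClosed_isBounded hTcl
        (isBounded_iff_forall_norm_le.2 ⟨|N| + Real.pi, fun w hw => ?_⟩)
      refine (norm_le_abs_re_add_abs_im w).trans (add_le_add ?_ ?_)
      · by_contra! h
        have := hN w hw.1 ((le_abs_self N).trans h.le)
        linarith [hw.2]
      · rw [abs_of_pos hw.1.1]; exact hw.1.2.le
    obtain ⟨w₁, hw₁, hmax⟩ := hTc.exists_isMaxOn ⟨w', hw', hbig.le⟩
      (f := fun w => ‖F w‖) ((hFd.continuousOn.mono fun w hw => hw.1).norm)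
    have hmaxS : IsMaxOn (norm ∘ F) strip w₁ := by
      intro w hw
      by_cases h : 1 + η ≤ ‖F w‖
      · exact hmax ⟨hw, h⟩
      · exact (not_le.1 h).le.trans hw₁.2
    have hconst := norm_eqOn_of_isPreconnected_of_isMaxOn convex_strip.isPreconnected isOpen_strip
      hFd hw₁.1 hmaxS
    set wf : ℂ := (|N| : ℝ) + (Real.pi / 2 : ℝ) * I with hwf
    have hwfs : wf ∈ strip := by
      constructor <;> simp [hwf] <;> linarith [Real.pi_pos]
    have h1 := hconst hwfs
    have h2 := hN wf hwfs (by simp [hwf]; exact le_abs_self N)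
    simp only [Function.comp_apply, Function.const_apply] at h1
    linarith [hw₁.2]
  intro w hw
  have h1 : ∀ ε > 0, ‖f w * exp (-(ε : ℝ) * q w)‖ ≤ 1 := by
    intro ε hε
    exact le_of_forall_pos_le_add fun η hη => main ε hε η hη w hw
  have h2 : Tendsto (fun ε : ℝ => ‖f w * exp (-(ε : ℝ) * q w)‖) (𝓝[>] 0)
      (𝓝 ‖f w * exp (-((0 : ℝ) : ℂ) * q w)‖) := by
    have : Continuous (fun ε : ℝ => ‖f w * exp (-(ε : ℝ) * q w)‖) := by fun_prop
    exact this.continuousAt.tendsto.mono_left nhdsWithin_le_nhds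
  have h3 := le_of_tendsto h2 (eventually_mem_nhdsWithin.mono fun ε hε => h1 ε hε)
  simpa using h3

/-! ### `G_α` in the logarithmic coordinate -/

lemma rpow_mul_rpow_le {α : ℝ} (hα : α ∈ Ioo (0 : ℝ) 1) {y t : ℝ} (hy : 0 ≤ y) (ht : 0 ≤ t) :
    y ^ α * t ^ (1 - α) ≤ α * y + (1 - α) * t :=
  Real.geom_mean_le_arith_mean2_weighted hα.1.le (by linarith [hα.2]) hy ht (by ring)

lemma integrableOn_exp_rpow_sub {α : ℝ} (hα : α ∈ Ioo (0 : ℝ) 1) (c : ℝ) :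
    IntegrableOn (fun y : ℝ => Real.exp (c * y ^ α - y)) (Ioi 0) := by
  have h1 : 0 < 1 - α := by linarith [hα.2]
  have hint : IntegrableOn (fun y : ℝ => Real.exp ((1 - α) * |c| ^ (1 / (1 - α))) *
      Real.exp (-(1 - α) * y)) (Ioi 0) :=
    (integrableOn_exp_mul_Ioi (a := -(1 - α)) (by linarith) 0).const_mul _
  have hm : AEStronglyMeasurable (fun y : ℝ => Real.exp (c * y ^ α - y))
      (volume.restrict (Ioi 0)) := by
    have : Continuous fun y : ℝ => y ^ α := Real.continuous_rpow_const hα.1.le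
    exact (by fun_prop : Continuous fun y : ℝ => Real.exp (c * y ^ α - y)).aestronglyMeasurable
  refine hint.mono' hm ((ae_restrict_mem measurableSet_Ioi).mono fun y hy => ?_)
  have hy0 : 0 ≤ y := le_of_lt hy
  rw [Real.norm_of_nonneg (Real.exp_pos _).le, ← Real.exp_add, Real.exp_le_exp]
  have h2 := rpow_mul_rpow_le hα hy0 (Real.rpow_nonneg (abs_nonneg c) (1 / (1 - α)))
  rw [← Real.rpow_mul (abs_nonneg c), one_div_mul_cancel h1.ne', Real.rpow_one] at h2
  have h3 : c * y ^ α ≤ y ^ α * |c| := by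
    rw [mul_comm]; exact mul_le_mul_of_nonneg_left (le_abs_self c) (Real.rpow_nonneg hy0 _)
  linarith

/-- The entire function `M(u) = ∫₀^∞ e^{-u y^α} e^{-y} dy`. -/
noncomputable def expRpowIntegral (α : ℝ) (u : ℂ) : ℂ :=
  ∫ y in Ioi (0 : ℝ), exp (-(u * ((y ^ α : ℝ) : ℂ)) - (y : ℂ))

lemma continuous_expRpow {α : ℝ} (hα : 0 < α) (u : ℂ) :
    Continuous fun y : ℝ => exp (-(u * ((y ^ α : ℝ) : ℂ)) - (y : ℂ)) := by
  have : Continuous fun y : ℝ => y ^ α := Real.continuous_rpow_const hα.le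
  fun_prop

lemma norm_expRpow (α : ℝ) (u : ℂ) (y : ℝ) :
    ‖exp (-(u * ((y ^ α : ℝ) : ℂ)) - (y : ℂ))‖ = Real.exp (-u.re * y ^ α - y) := by
  rw [norm_exp]; congr 1
  rw [sub_re, neg_re, mul_comm, re_ofReal_mul, ofReal_re]; ring

lemma integrableOn_expRpow {α : ℝ} (hα : α ∈ Ioo (0 : ℝ) 1) (u : ℂ) :
    IntegrableOn (fun y : ℝ => exp (-(u * ((y ^ α : ℝ) : ℂ)) - (y : ℂ))) (Ioi 0) := by
  refine (integrableOn_exp_rpow_sub hα (-u.re)).mono'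
    (continuous_expRpow hα.1 u).aestronglyMeasurable (ae_of_all _ fun y => ?_)
  rw [norm_expRpow]

lemma differentiable_expRpowIntegral {α : ℝ} (hα : α ∈ Ioo (0 : ℝ) 1) :
    Differentiable ℂ (expRpowIntegral α) := by
  intro u
  have hc : Continuous fun y : ℝ => y ^ α := Real.continuous_rpow_const hα.1.le
  refine (hasDerivAt_integral_of_dominated_loc_of_deriv_le (μ := volume.restrict (Ioi (0 : ℝ)))
    (F := fun (u : ℂ) (y : ℝ) => exp (-(u * ((y ^ α : ℝ) : ℂ)) - (y : ℂ)))
    (F' := fun (u : ℂ) (y : ℝ) => exp (-(u * ((y ^ α : ℝ) : ℂ)) - (y : ℂ)) * -((y ^ α : ℝ) : ℂ))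
    (bound := fun y => Real.exp ((‖u‖ + 2) * y ^ α - y))
    (Metric.ball_mem_nhds u one_pos)
    (Eventually.of_forall fun u => (continuous_expRpow hα.1 u).aestronglyMeasurable)
    (integrableOn_expRpow hα u) ?_ ?_ (integrableOn_exp_rpow_sub hα _) ?_).2.differentiableAt
  · exact (by fun_prop : Continuous fun y : ℝ =>
      exp (-(u * ((y ^ α : ℝ) : ℂ)) - (y : ℂ)) * -((y ^ α : ℝ) : ℂ)).aestronglyMeasurable
  · refine (ae_restrict_mem measurableSet_Ioi).mono fun y hy x hx => ?_
    have hp : 0 ≤ y ^ α := Real.rpow_nonneg (le_of_lt hy) _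
    rw [norm_mul, norm_expRpow, norm_neg, norm_real, Real.norm_of_nonneg hp]
    have h1 : y ^ α ≤ Real.exp (y ^ α) := by linarith [Real.add_one_le_exp (y ^ α)]
    have h2 : -x.re ≤ ‖u‖ + 1 := by
      have h3 : ‖x‖ ≤ ‖u‖ + ‖x - u‖ := by simpa using norm_add_le u (x - u)
      have h4 : ‖x - u‖ < 1 := by simpa [dist_eq_norm] using hx
      have := (abs_le.1 (abs_re_le_norm x)).1
      linarith
    calc Real.exp (-x.re * y ^ α - y) * y ^ α
        ≤ Real.exp (-x.re * y ^ α - y) * Real.exp (y ^ α) := by gcongr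
      _ = Real.exp ((-x.re + 1) * y ^ α - y) := by rw [← Real.exp_add]; ring_nf
      _ ≤ _ := by
        apply Real.exp_le_exp.2
        nlinarith
  · refine ae_of_all _ fun y x _ => ?_
    have h := ((((hasDerivAt_id x).mul_const ((y ^ α : ℝ) : ℂ)).neg).sub_const (y : ℂ)).cexp
    simpa using h

/-- The function `G_α` in the logarithmic coordinate `z = e^w`; it is entire in `w`. -/
noncomputable def logG (α : ℝ) (w : ℂ) : ℂ :=
  (2 * I * (Real.pi : ℂ))⁻¹ * (exp (-w) *
    (expRpowIntegral α (exp ((1 - α) * w + α * ((-Real.pi : ℝ) * I))) -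
      expRpowIntegral α (exp ((1 - α) * w + α * ((Real.pi : ℝ) * I)))))

lemma differentiable_logG {α : ℝ} (hα : α ∈ Ioo (0 : ℝ) 1) : Differentiable ℂ (logG α) := by
  have := differentiable_expRpowIntegral hα
  unfold logG
  fun_prop

lemma G_eq_logG {α : ℝ} (hα : α ∈ Ioo (0 : ℝ) 1) {z : ℂ} (hz : z ≠ 0) :
    G α z = logG α (log z) := by
  have hpow : z ^ (1 - (α : ℂ)) = exp ((1 - α) * log z) := by
    rw [cpow_def_of_ne_zero hz, mul_comm]
  have hinv : exp (-log z) = z⁻¹ := by rw [exp_neg, exp_log hz]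
  rw [G, logG, expRpowIntegral, expRpowIntegral,
    ← integral_sub (integrableOn_expRpow hα _) (integrableOn_expRpow hα _),
    ← integral_const_mul (exp (-log z))]
  congr 1
  refine setIntegral_congr_fun measurableSet_Ioi fun y _ => ?_
  rw [hinv, hpow, sub_eq_add_neg _ (y : ℂ), sub_eq_add_neg _ (y : ℂ), exp_add _ (-(y : ℂ)),
    exp_add _ (-(y : ℂ)), exp_add, exp_add, ofReal_neg]
  have h1 : exp ((α : ℂ) * (-(Real.pi : ℂ) * I)) = exp (-(I * Real.pi * α)) := by ring_nf
  have h2 : exp ((α : ℂ) * ((Real.pi : ℂ) * I)) = exp (I * Real.pi * α) := by ring_nf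
  rw [h1, h2]
  ring_nf

/-- Each of the two terms of `G_α` is an integral of `e^{z (ζ - ζ^α)}` along a ray. -/
lemma exp_neg_mul_expRpowIntegral (α : ℝ) (w : ℂ) {β : ℝ} (hβ : exp (β * I) = -1) :
    exp (-w) * expRpowIntegral α (exp ((1 - α) * w + α * (β * I))) =
      -∫ v in Ioi (0 : ℝ), exp ((β - w.im : ℝ) * I) * saddleExp α (exp w) v (β - w.im) := by
  have hr : 0 < Real.exp w.re := Real.exp_pos _
  set f : ℝ → ℂ := fun y =>
    exp (-(exp ((1 - α) * w + α * (β * I)) * ((y ^ α : ℝ) : ℂ)) - (y : ℂ)) with hf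
  have h1 : expRpowIntegral α (exp ((1 - α) * w + α * (β * I))) =
      (Real.exp w.re : ℂ) * ∫ v in Ioi (0 : ℝ), f (Real.exp w.re * v) := by
    rw [integral_comp_mul_left_Ioi f 0 hr, mul_zero, real_smul, ofReal_inv,
      mul_inv_cancel_left₀ (ofReal_ne_zero.2 hr.ne')]
    rfl
  have hw : w = w.re + w.im * I := (re_add_im w).symm
  rw [h1, ← mul_assoc, ← integral_const_mul, ← integral_neg]
  refine setIntegral_congr_fun measurableSet_Ioi fun v hv => ?_
  have hv0 : 0 < v := hv
  have hpre : exp (-w) * (Real.exp w.re : ℂ) = -exp ((β - w.im : ℝ) * I) := by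
    rw [ofReal_exp, ← exp_add]
    have : ((β - w.im : ℝ) : ℂ) * I = β * I + (-w + w.re) := by
      rw [ofReal_sub]; linear_combination hw
    rw [this, exp_add (β * I), hβ]; ring
  rw [hpre, neg_mul]
  congr 2
  simp only [hf, saddleExp]
  congr 1
  have e1 : exp w * (v * exp ((β - w.im : ℝ) * I)) = -((Real.exp w.re * v : ℝ) : ℂ) := by
    have : exp ((β - w.im : ℝ) * I) = -(exp (-w) * Real.exp w.re) := by rw [hpre, neg_neg]
    rw [this, exp_neg]
    push_cast
    field_simp [exp_ne_zero w]
  have e2 : exp w * (((v ^ α : ℝ) : ℂ) * exp ((α * (β - w.im) : ℝ) * I)) =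
      exp ((1 - α) * w + α * (β * I)) * (((Real.exp w.re * v) ^ α : ℝ) : ℂ) := by
    rw [Real.mul_rpow hr.le hv0.le, ← Real.exp_mul]
    have : exp w * exp ((α * (β - w.im) : ℝ) * I) =
        exp ((1 - α) * w + α * (β * I)) * (Real.exp (w.re * α) : ℂ) := by
      rw [ofReal_exp, ← exp_add, ← exp_add]
      congr 1
      push_cast
      linear_combination (α : ℂ) * hw
    rw [ofReal_mul (Real.exp (w.re * α))]
    linear_combination ((v ^ α : ℝ) : ℂ) * this
  rw [mul_sub, e1, e2]; ring

lemma norm_saddleExp_exp (α : ℝ) (w : ℂ) (v u : ℝ) :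
    ‖saddleExp α (exp w) v u‖ =
      Real.exp (Real.exp w.re * (v * Real.cos (u + w.im) - v ^ α * Real.cos (α * u + w.im))) := by
  have hw : exp w = Real.exp w.re * exp (w.im * I) := by
    rw [ofReal_exp, ← exp_add, re_add_im]
  rw [saddleExp, norm_exp, hw]
  congr 1
  have : (Real.exp w.re : ℂ) * exp (w.im * I) * ((v : ℂ) * exp (u * I) -
      ((v ^ α : ℝ) : ℂ) * exp ((α * u : ℝ) * I)) =
      (Real.exp w.re : ℂ) * ((v : ℂ) * exp ((u + w.im : ℝ) * I) -
        ((v ^ α : ℝ) : ℂ) * exp ((α * u + w.im : ℝ) * I)) := by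
    rw [ofReal_add u, ofReal_add (α * u), add_mul, add_mul, exp_add, exp_add]; ring
  rw [this, re_ofReal_mul, sub_re, re_ofReal_mul, re_ofReal_mul, exp_ofReal_mul_I_re,
    exp_ofReal_mul_I_re]

lemma delta_pos {α : ℝ} (hα : α ∈ Ioo (0 : ℝ) 1) : 0 < delta α :=
  mul_pos (by linarith [hα.2]) (Real.rpow_pos_of_pos hα.1 _)

/-- The saddle point `α^{1/(1-α)}` of `ζ - ζ^α`. -/
noncomputable def saddlePoint (α : ℝ) : ℝ := α ^ (1 / (1 - α))

lemma saddlePoint_pos {α : ℝ} (hα : α ∈ Ioo (0 : ℝ) 1) : 0 < saddlePoint α :=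
  Real.rpow_pos_of_pos hα.1 _

lemma saddlePoint_rpow {α : ℝ} (hα : α ∈ Ioo (0 : ℝ) 1) :
    saddlePoint α ^ α = delta α / (1 - α) := by
  have h1 : 0 < 1 - α := by linarith [hα.2]
  rw [delta, saddlePoint, ← Real.rpow_mul hα.1.le, mul_div_cancel_left₀ _ h1.ne']
  congr 1; ring

lemma saddlePoint_eq {α : ℝ} (hα : α ∈ Ioo (0 : ℝ) 1) :
    saddlePoint α = α * saddlePoint α ^ α := by
  have h1 : 0 < 1 - α := by linarith [hα.2]
  have h2 : saddlePoint α ^ (1 - α) = α := by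
    rw [saddlePoint, ← Real.rpow_mul hα.1.le, one_div_mul_cancel h1.ne', Real.rpow_one]
  conv_lhs => rw [← Real.rpow_one (saddlePoint α), show (1 : ℝ) = (1 - α) + α by ring,
    Real.rpow_add (saddlePoint_pos hα), h2]

/-- `δ` is the maximum of `v^α - v`, attained at the saddle point. -/
lemma rpow_sub_le_delta {α : ℝ} (hα : α ∈ Ioo (0 : ℝ) 1) {v : ℝ} (hv : 0 ≤ v) :
    v ^ α - v ≤ delta α := by
  have h1 : 0 < 1 - α := by linarith [hα.2]
  have hs := saddlePoint_pos hα
  have h2 : saddlePoint α ^ (1 - α) = α := by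
    rw [saddlePoint, ← Real.rpow_mul hα.1.le, one_div_mul_cancel h1.ne', Real.rpow_one]
  have h3 := rpow_mul_rpow_le hα hv hs.le
  rw [h2] at h3
  have h4 := saddlePoint_eq hα
  have h5 : delta α = (1 - α) * saddlePoint α ^ α := by
    rw [saddlePoint_rpow hα]; field_simp
  have h6 : α * (v ^ α - v) ≤ α * delta α := by
    rw [h5]
    nlinarith
  exact le_of_mul_le_mul_left h6 hα.1

/-- `e^{δz} G_α(z)` in the logarithmic coordinate `z = e^w`. -/
noncomputable def logK (α : ℝ) (w : ℂ) : ℂ := logG α w * exp (delta α * exp w)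

lemma differentiable_logK {α : ℝ} (hα : α ∈ Ioo (0 : ℝ) 1) : Differentiable ℂ (logK α) := by
  have := differentiable_logG hα
  unfold logK
  fun_prop

lemma norm_logK (α : ℝ) (w : ℂ) :
    ‖logK α w‖ = ‖logG α w‖ * Real.exp (delta α * (Real.exp w.re * Real.cos w.im)) := by
  rw [logK, norm_mul, norm_exp, re_ofReal_mul, exp_re]

lemma norm_logG_le_of_rays (α : ℝ) (w : ℂ) {A B : ℝ}
    (hA : ‖∫ v in Ioi (0 : ℝ), exp ((-Real.pi - w.im : ℝ) * I) *
      saddleExp α (exp w) v (-Real.pi - w.im)‖ ≤ A)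
    (hB : ‖∫ v in Ioi (0 : ℝ), exp ((Real.pi - w.im : ℝ) * I) *
      saddleExp α (exp w) v (Real.pi - w.im)‖ ≤ B) :
    ‖logG α w‖ ≤ A + B := by
  rw [logG, mul_sub, exp_neg_mul_expRpowIntegral α w (by simp [exp_neg]),
    exp_neg_mul_expRpowIntegral α w (by simp), norm_mul, norm_inv]
  have h1 : 1 ≤ ‖2 * I * (Real.pi : ℂ)‖ := by
    rw [norm_mul, norm_mul, norm_I, norm_real, Real.norm_of_nonneg Real.pi_pos.le]
    norm_num; linarith [Real.pi_gt_three]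
  refine (mul_le_of_le_one_left (norm_nonneg _) (inv_le_one_of_one_le₀ h1)).trans ?_
  refine (norm_sub_le _ _).trans ?_
  rw [norm_neg, norm_neg]
  exact add_le_add hA hB

lemma norm_exp_mul_saddleExp (α : ℝ) (w : ℂ) (v u : ℝ) :
    ‖exp (u * I) * saddleExp α (exp w) v u‖ =
      Real.exp (Real.exp w.re * (v * Real.cos (u + w.im) - v ^ α * Real.cos (α * u + w.im))) := by
  rw [norm_mul, norm_exp_ofReal_mul_I, one_mul, norm_saddleExp_exp]

/-- A bound of `G_α` of the order `e^{δ|z|}` outside the unit disc; it is sharp on the negative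
axis. -/
lemma exists_norm_logG_le_exp {α : ℝ} (hα : α ∈ Ioo (0 : ℝ) 1) :
    ∃ C : ℝ, ∀ w : ℂ, 0 ≤ w.re → ‖logG α w‖ ≤ C * Real.exp (delta α * Real.exp w.re) := by
  set B : ℝ := ∫ v in Ioi (0 : ℝ), Real.exp (-(delta α)) * Real.exp (1 * v ^ α - v) with hB
  have hint := (integrableOn_exp_rpow_sub hα 1).const_mul (Real.exp (-(delta α)))
  refine ⟨2 * B, fun w hw => ?_⟩
  have hr : 1 ≤ Real.exp w.re := Real.one_le_exp hw
  have key : ∀ β : ℝ, Real.cos β = -1 → ‖∫ v in Ioi (0 : ℝ), exp ((β - w.im : ℝ) * I) *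
      saddleExp α (exp w) v (β - w.im)‖ ≤ B * Real.exp (delta α * Real.exp w.re) := by
    intro β hβ
    rw [hB, ← integral_mul_const]
    refine norm_integral_le_of_norm_le (hint.mul_const _)
      ((ae_restrict_mem measurableSet_Ioi).mono fun v hv => ?_)
    have hv0 : 0 ≤ v := le_of_lt hv
    rw [norm_exp_mul_saddleExp, ← Real.exp_add, ← Real.exp_add, Real.exp_le_exp, sub_add_cancel, hβ]
    have h1 := rpow_sub_le_delta hα hv0
    have h2 : -(v ^ α * Real.cos (α * (β - w.im) + w.im)) ≤ v ^ α := by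
      nlinarith [Real.neg_one_le_cos (α * (β - w.im) + w.im), Real.rpow_nonneg hv0 α]
    have h3 : Real.exp w.re * (v * -1 - v ^ α * Real.cos (α * (β - w.im) + w.im)) ≤
        Real.exp w.re * (v ^ α - v) := by
      apply mul_le_mul_of_nonneg_left _ (by linarith); linarith
    nlinarith
  have := norm_logG_le_of_rays α w (key _ (by simp)) (key _ (by simp))
  linarith

/-- `G_α(z) = O(|z|^{-α})` in the unit disc. -/
lemma exists_norm_logG_le_rpow {α : ℝ} (hα : α ∈ Ioo (0 : ℝ) 1) :
    ∃ C : ℝ, ∀ w : ℂ, w.re ≤ 0 → ‖logG α w‖ ≤ C * Real.exp (-α * w.re) := by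
  have hd := differentiable_expRpowIntegral hα
  have hdc : Continuous (deriv (expRpowIntegral α)) :=
    (hd.contDiff (n := 1)).continuous_deriv le_rfl
  obtain ⟨C, hC⟩ := (isCompact_closedBall (0 : ℂ) 1).exists_bound_of_continuousOn hdc.continuousOn
  refine ⟨C * 2, fun w hw => ?_⟩
  have h1α : 0 < 1 - α := by linarith [hα.2]
  have hn : ∀ β : ℝ, ‖exp ((1 - α) * w + α * (β * I))‖ = Real.exp ((1 - α) * w.re) := by
    intro β
    rw [norm_exp]; congr 1
    simp
  have hle : Real.exp ((1 - α) * w.re) ≤ 1 := by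
    rw [Real.exp_le_one_iff]; nlinarith
  have hmem : ∀ β : ℝ, exp ((1 - α) * w + α * (β * I)) ∈ Metric.closedBall (0 : ℂ) 1 := by
    intro β; rw [mem_closedBall_zero_iff, hn]; exact hle
  have hlip := (convex_closedBall (0 : ℂ) 1).norm_image_sub_le_of_norm_deriv_le
    (f := expRpowIntegral α) (fun x _ => hd x) hC (hmem Real.pi) (hmem (-Real.pi))
  have hC0 : 0 ≤ C := (norm_nonneg _).trans (hC 0 (by simp))
  have hπ : 1 ≤ ‖2 * I * (Real.pi : ℂ)‖ := by
    rw [norm_mul, norm_mul, norm_I, norm_real, Real.norm_of_nonneg Real.pi_pos.le]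
    norm_num; linarith [Real.pi_gt_three]
  rw [logG, norm_mul, norm_inv]
  refine le_trans (mul_le_of_le_one_left ?_ (inv_le_one_of_one_le₀ hπ)) ?_
  · exact norm_nonneg _
  have h2 : ‖exp (-w)‖ = Real.exp (-w.re) := by rw [norm_exp, neg_re]
  rw [norm_mul, h2]
  calc Real.exp (-w.re) * _ ≤ Real.exp (-w.re) * (C * (Real.exp ((1 - α) * w.re) +
        Real.exp ((1 - α) * w.re))) := by
        refine mul_le_mul_of_nonneg_left (hlip.trans ?_) (Real.exp_pos _).le
        refine mul_le_mul_of_nonneg_left ((norm_sub_le _ _).trans_eq ?_) hC0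
        rw [hn, hn]
    _ = C * 2 * (Real.exp (-w.re) * Real.exp ((1 - α) * w.re)) := by ring
    _ = C * 2 * Real.exp (-α * w.re) := by rw [← Real.exp_add]; ring_nf

/-! ### Deformation of the contours -/

lemma continuous_ray {α : ℝ} (hα : 0 < α) (z : ℂ) (u : ℝ) :
    Continuous fun v : ℝ => exp (u * I) * saddleExp α z v u :=
  continuous_const.mul ((continuous_saddleExp hα z).comp (continuous_id.prodMk continuous_const))

lemma continuous_arc {α : ℝ} (hα : 0 < α) (z : ℂ) (b : ℝ) :
    Continuous fun u : ℝ => I * ((b : ℂ) * exp (u * I) * saddleExp α z b u) := by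
  have : Continuous fun u : ℝ => saddleExp α z b u :=
    (continuous_saddleExp hα z).comp (continuous_const.prodMk continuous_id)
  fun_prop

lemma norm_arc (α : ℝ) (w : ℂ) {b : ℝ} (hb : 0 ≤ b) (u : ℝ) :
    ‖I * ((b : ℂ) * exp (u * I) * saddleExp α (exp w) b u)‖ =
      b * Real.exp (Real.exp w.re * (b * Real.cos (u + w.im) - b ^ α * Real.cos (α * u + w.im))) := by
  rw [norm_mul, norm_I, one_mul, mul_assoc, norm_mul, norm_exp_mul_saddleExp, norm_real,
    Real.norm_of_nonneg hb]

lemma integrableOn_ray {α : ℝ} (hα : α ∈ Ioo (0 : ℝ) 1) {w : ℂ} (hw : 0 ≤ w.re) {β : ℝ}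
    (hβ : Real.cos β = -1) :
    IntegrableOn (fun v : ℝ => exp ((β - w.im : ℝ) * I) * saddleExp α (exp w) v (β - w.im))
      (Ioi 0) := by
  have hr : 1 ≤ Real.exp w.re := Real.one_le_exp hw
  refine ((integrableOn_exp_rpow_sub hα 1).const_mul
    (Real.exp ((Real.exp w.re - 1) * delta α))).mono'
    (continuous_ray hα.1 _ _).aestronglyMeasurable
    ((ae_restrict_mem measurableSet_Ioi).mono fun v hv => ?_)
  have hv0 : 0 ≤ v := le_of_lt hv
  rw [norm_exp_mul_saddleExp, ← Real.exp_add, Real.exp_le_exp, sub_add_cancel, hβ]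
  have h1 := rpow_sub_le_delta hα hv0
  have h2 : -(v ^ α * Real.cos (α * (β - w.im) + w.im)) ≤ v ^ α := by
    nlinarith [Real.neg_one_le_cos (α * (β - w.im) + w.im), Real.rpow_nonneg hv0 α]
  have h3 : Real.exp w.re * (v * -1 - v ^ α * Real.cos (α * (β - w.im) + w.im)) ≤
      Real.exp w.re * (v ^ α - v) := by
    apply mul_le_mul_of_nonneg_left _ (by linarith); linarith
  nlinarith

/-- A bound, uniform on the imaginary half-axis, of the integral along a ray, by means of the
contour made of the unit segment at the angle `u₀`, an arc of the unit circle, and the rest of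
the ray. -/
lemma norm_ray_imaginary_le {α : ℝ} (hα : α ∈ Ioo (0 : ℝ) 1) {w : ℂ} (hw : 0 ≤ w.re)
    (him : w.im = Real.pi / 2) {β u₀ : ℝ} (hβ : Real.cos β = -1)
    (h₀ : Real.sin (α * u₀) ≤ 0) (h₀' : Real.sin u₀ = 0)
    (harc : ∀ u ∈ uIoc u₀ (β - w.im), Real.sin (α * u) ≤ Real.sin u) :
    ‖∫ v in Ioi (0 : ℝ), exp ((β - w.im : ℝ) * I) * saddleExp α (exp w) v (β - w.im)‖ ≤
      1 + |β - w.im - u₀| + ∫ v in Ioi (1 : ℝ), Real.exp (1 * v ^ α - v) := by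
  have hr : 1 ≤ Real.exp w.re := Real.one_le_exp hw
  have hcos : ∀ x : ℝ, Real.cos (x + w.im) = -Real.sin x := by
    intro x; rw [him, Real.cos_add_pi_div_two]
  have hint := integrableOn_ray hα hw hβ
  rw [← intervalIntegral.integral_interval_add_Ioi hint
    (hint.mono_set (Ioi_subset_Ioi zero_le_one)),
    integral_saddleExp_rotate hα.1 (exp w) one_pos u₀ (β - w.im)]
  refine (norm_add_le _ _).trans (add_le_add ((norm_add_le _ _).trans (add_le_add ?_ ?_)) ?_)
  · refine (intervalIntegral.norm_integral_le_of_norm_le_const (C := 1) fun v hv => ?_).trans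
      (by simp)
    rw [uIoc_of_le zero_le_one] at hv
    rw [norm_exp_mul_saddleExp, Real.exp_le_one_iff, hcos, hcos, h₀']
    have := Real.rpow_nonneg hv.1.le α
    nlinarith [mul_nonneg (mul_nonneg (Real.exp_pos w.re).le this) (neg_nonneg.2 h₀)]
  · refine (intervalIntegral.norm_integral_le_of_norm_le_const (C := 1) fun u hu => ?_).trans
      (by simp)
    rw [norm_arc α w zero_le_one, one_mul, Real.exp_le_one_iff, hcos, hcos, Real.one_rpow]
    nlinarith [harc u hu]
  · refine norm_integral_le_of_norm_le
      ((integrableOn_exp_rpow_sub hα 1).mono_set (Ioi_subset_Ioi zero_le_one))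
      ((ae_restrict_mem measurableSet_Ioi).mono fun v hv => ?_)
    have hv1 : 1 ≤ v := le_of_lt hv
    rw [norm_exp_mul_saddleExp, Real.exp_le_exp, sub_add_cancel, hβ, hcos]
    have h1 : v ^ α ≤ v := by
      conv_rhs => rw [← Real.rpow_one v]
      exact Real.rpow_le_rpow_of_exponent_le hv1 hα.2.le
    have h2 := Real.sin_le_one (α * (β - w.im))
    have h3 : 0 ≤ v ^ α := Real.rpow_nonneg (by linarith) α
    have h4 : v * -1 - v ^ α * -Real.sin (α * (β - w.im)) ≤ v ^ α - v := by nlinarith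
    nlinarith [mul_le_mul_of_nonneg_left h4 (Real.exp_pos w.re).le]

/-- `G_α` is bounded on the part of the imaginary half-axis outside the unit disc. -/
lemma exists_norm_logG_imaginary_le {α : ℝ} (hα : α ∈ Ioo (0 : ℝ) 1) :
    ∃ C : ℝ, ∀ w : ℂ, 0 ≤ w.re → w.im = Real.pi / 2 → ‖logG α w‖ ≤ C := by
  have hπ := Real.pi_pos
  refine ⟨_, fun w hw him => norm_logG_le_of_rays α w
    ((norm_ray_imaginary_le hα hw him (u₀ := -Real.pi) (by simp) ?_ (by simp) ?_).trans_eq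
      (by rw [him]))
    ((norm_ray_imaginary_le hα hw him (u₀ := 0) (by simp) (by simp) (by simp) ?_).trans_eq
      (by rw [him]))⟩
  · rw [mul_neg, Real.sin_neg, neg_nonpos]
    exact Real.sin_nonneg_of_nonneg_of_le_pi (by nlinarith [hα.1]) (by nlinarith [hα.2])
  · intro u hu
    rw [him, uIoc_of_ge (by linarith)] at hu
    -- with `u = -π - γ` the inequality reads `-sin γ ≤ sin (α (π + γ))`
    obtain ⟨γ, rfl⟩ : ∃ γ, u = -(Real.pi + γ) := ⟨-u - Real.pi, by ring⟩
    have hγ0 : 0 ≤ γ := by linarith [hu.2]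
    have hγ1 : γ ≤ Real.pi / 2 := by linarith [hu.1]
    rw [mul_neg, Real.sin_neg, Real.sin_neg, add_comm Real.pi, Real.sin_add_pi]
    have hsγ : 0 ≤ Real.sin γ := Real.sin_nonneg_of_nonneg_of_le_pi hγ0 (by linarith)
    rcases le_total (α * (γ + Real.pi)) Real.pi with h | h
    · have : 0 ≤ Real.sin (α * (γ + Real.pi)) :=
        Real.sin_nonneg_of_nonneg_of_le_pi (by nlinarith [hα.1]) h
      linarith
    · have h1 : Real.sin (α * (γ + Real.pi)) = -Real.sin (α * (γ + Real.pi) - Real.pi) := by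
        rw [Real.sin_sub_pi]; ring
      have h2 : Real.sin (α * (γ + Real.pi) - Real.pi) ≤ Real.sin γ :=
        Real.sin_le_sin_of_le_of_le_pi_div_two (by linarith) hγ1 (by nlinarith [hα.2])
      linarith
  · intro u hu
    rw [him, uIoc_of_le (by linarith)] at hu
    exact Real.sin_le_sin_of_le_of_le_pi_div_two (by nlinarith [hα.1, hu.1]) (by linarith [hu.2])
      (by nlinarith [hα.2, hu.1])

lemma conj_saddleExp (α : ℝ) (s v u : ℝ) :
    (starRingEnd ℂ) (exp (u * I) * saddleExp α (exp s) v u) =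
      exp ((-u : ℝ) * I) * saddleExp α (exp s) v (-u) := by
  simp only [saddleExp, map_mul, ← exp_conj, map_sub, conj_ofReal, conj_I]
  push_cast
  ring_nf

/-- On the positive axis `π G_α` is the imaginary part of a single ray integral. -/
lemma logG_ofReal (α s : ℝ) :
    logG α s = (((∫ v in Ioi (0 : ℝ), exp ((Real.pi : ℝ) * I) *
      saddleExp α (exp s) v Real.pi).im / Real.pi : ℝ) : ℂ) := by
  have h1 := exp_neg_mul_expRpowIntegral α s (β := -Real.pi) (by simp [exp_neg])
  have h2 := exp_neg_mul_expRpowIntegral α s (β := Real.pi) (by simp)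
  simp only [ofReal_im, sub_zero] at h1 h2
  set U : ℂ := ∫ v in Ioi (0 : ℝ), exp ((Real.pi : ℝ) * I) * saddleExp α (exp s) v Real.pi with hU
  have h3 : ∫ v in Ioi (0 : ℝ), exp ((-Real.pi : ℝ) * I) * saddleExp α (exp s) v (-Real.pi) =
      (starRingEnd ℂ) U := by
    rw [hU, ← integral_conj]
    exact setIntegral_congr_fun measurableSet_Ioi fun v _ => (conj_saddleExp α s v Real.pi).symm
  rw [logG, mul_sub, h1, h2, h3]
  have h4 : -(starRingEnd ℂ) U - -U = (2 * U.im : ℝ) * I := by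
    rw [← sub_conj]; ring
  have hπ : (Real.pi : ℂ) ≠ 0 := ofReal_ne_zero.2 Real.pi_ne_zero
  rw [h4]
  push_cast
  field_simp

lemma logK_ofReal_im {α : ℝ} (s : ℝ) : (logK α s).im = 0 := by
  rw [logK, logG_ofReal, ← ofReal_exp, ← ofReal_mul, ← ofReal_exp, ← ofReal_mul, ofReal_im]

/-- A Laplace integral in the large parameter `e^s` whose phase is negative almost everywhere
tends to zero. -/
lemma tendsto_integral_exp_decay {μ : Measure ℝ} {F : ℝ → ℝ → ℂ} {h : ℝ → ℝ} {c : ℝ}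
    (hm : ∀ s, AEStronglyMeasurable (F s) μ)
    (hF : ∀ s t, ‖F s t‖ = c * Real.exp (Real.exp s * h t))
    (hneg : ∀ᵐ t ∂μ, h t < 0) (hint : Integrable (fun t => Real.exp (h t)) μ) :
    Tendsto (fun s => ∫ t, F s t ∂μ) atTop (𝓝 0) := by
  have := tendsto_integral_filter_of_dominated_convergence (μ := μ) (F := F) (f := fun _ => 0)
    (l := atTop) (fun t => |c| * Real.exp (h t)) (Eventually.of_forall hm) ?_ (hint.const_mul _) ?_
  · simpa using this
  · filter_upwards [eventually_ge_atTop 0] with s hs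
    filter_upwards [hneg] with t hn
    have h1 := Real.one_le_exp hs
    rw [hF]
    refine mul_le_mul (le_abs_self c) (Real.exp_le_exp.2 ?_) (Real.exp_pos _).le (abs_nonneg c)
    nlinarith
  · filter_upwards [hneg] with t hn
    rw [tendsto_zero_iff_norm_tendsto_zero]
    simp_rw [hF]
    rw [show (0 : ℝ) = c * 0 by ring]
    refine Tendsto.const_mul c (Real.tendsto_exp_atBot.comp ?_)
    exact Real.tendsto_exp_atTop.atTop_mul_const_of_neg hn

lemma lt_cos_mul {α : ℝ} (hα : α ∈ Ioo (0 : ℝ) 1) {u : ℝ} (hu : 0 < u) (hu' : u ≤ Real.pi / 2) :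
    1 - α + α * Real.cos u < Real.cos (α * u) := by
  have hc := strictConcaveOn_cos_Icc.2
  have := @hc u ⟨by linarith, hu'⟩ 0 ⟨by linarith, by linarith⟩ hu.ne' α (1 - α) hα.1
    (by linarith [hα.2]) (by ring)
  simp only [smul_eq_mul, Real.cos_zero, mul_zero, add_zero, mul_one] at this
  linarith

/-- The height of the saddle is strictly below its value at the saddle point along the arc of
the circle through the saddle point up to the angle `π/2`. -/
lemma arc_saddlePoint_neg {α : ℝ} (hα : α ∈ Ioo (0 : ℝ) 1) {u : ℝ} (hu : 0 < u)
    (hu' : u ≤ Real.pi / 2) :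
    saddlePoint α * Real.cos u - saddlePoint α ^ α * Real.cos (α * u) + delta α < 0 := by
  have h1 : 0 < 1 - α := by linarith [hα.2]
  have h2 : delta α = (1 - α) * saddlePoint α ^ α := by rw [saddlePoint_rpow hα]; field_simp
  have h3 := Real.rpow_pos_of_pos (saddlePoint_pos hα) α
  rw [h2]
  nth_rewrite 1 [saddlePoint_eq hα]
  nlinarith [lt_cos_mul hα hu hu', mul_pos h3 (sub_pos.2 (lt_cos_mul hα hu hu'))]

lemma ray_pi_div_two_neg {α : ℝ} (hα : α ∈ Ioo (0 : ℝ) 1) {v : ℝ} (hv : saddlePoint α ≤ v) :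
    v * Real.cos (Real.pi / 2) - v ^ α * Real.cos (α * (Real.pi / 2)) + delta α < 0 := by
  have h0 := arc_saddlePoint_neg hα (u := Real.pi / 2) (by linarith [Real.pi_pos]) le_rfl
  have h1 := lt_cos_mul hα (u := Real.pi / 2) (by linarith [Real.pi_pos]) le_rfl
  have h2 : saddlePoint α ^ α ≤ v ^ α :=
    Real.rpow_le_rpow (saddlePoint_pos hα).le hv hα.1.le
  rw [Real.cos_pi_div_two] at *
  have h3 : 0 < Real.cos (α * (Real.pi / 2)) := by linarith [hα.2]
  nlinarith

/-- In the second quadrant the real part of `ζ - ζ^α` is below `-δ` far from the origin. -/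
lemma exists_second_quadrant_neg {α : ℝ} (hα : α ∈ Ioo (0 : ℝ) 1) :
    ∃ R : ℝ, saddlePoint α ≤ R ∧ ∀ v, R ≤ v → ∀ u, Real.pi / 2 ≤ u → u ≤ Real.pi →
      v * Real.cos u - v ^ α * Real.cos (α * u) + delta α < 0 := by
  have hπ := Real.pi_pos
  have h1α : 0 < 1 - α := by linarith [hα.2]
  have hc : 0 < Real.cos (α * (Real.pi / 2)) := by
    have := lt_cos_mul hα (u := Real.pi / 2) (by linarith) le_rfl
    rw [Real.cos_pi_div_two] at this
    linarith
  -- the constant `2` compensates `sin t ≥ t / 2` on `[0, π / 2]`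
  have e1 := (tendsto_rpow_atTop h1α).eventually_ge_atTop 2
  have e2 := (tendsto_rpow_atTop hα.1).eventually_gt_atTop (delta α / Real.cos (α * (Real.pi / 2)))
  obtain ⟨R, hR⟩ := eventually_atTop.1 ((e1.and e2).and (eventually_ge_atTop (saddlePoint α)))
  refine ⟨R, (hR R le_rfl).2, fun v hv u hu hu' => ?_⟩
  obtain ⟨⟨hv1, hv2⟩, hv3⟩ := hR v hv
  have hv0 : 0 < v := (saddlePoint_pos hα).trans_le hv3
  have hvα : 0 < v ^ α := Real.rpow_pos_of_pos hv0 α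
  rw [div_lt_iff₀ hc] at hv2
  have hv4 : v = v ^ α * v ^ (1 - α) := by
    rw [← Real.rpow_add hv0]; simp
  set t := u - Real.pi / 2 with ht
  have ht0 : 0 ≤ t := by linarith
  have hut : u = t + Real.pi / 2 := by linarith
  have hcu : Real.cos u = -Real.sin t := by rw [hut, Real.cos_add_pi_div_two]
  have hsin : t ≤ 2 * Real.sin t := by
    have := Real.mul_le_sin ht0 (by linarith)
    have h4 : 2 / Real.pi * t ≥ t / 2 := by
      have : (1 : ℝ) / 2 ≤ 2 / Real.pi := by
        rw [div_le_div_iff₀ two_pos hπ]; linarith [Real.pi_le_four]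
      nlinarith
    linarith
  have hlip : Real.cos (α * (Real.pi / 2)) - α * t ≤ Real.cos (α * u) := by
    have := Real.abs_cos_sub_cos_le (α * (Real.pi / 2)) (α * u)
    have h5 : |α * (Real.pi / 2) - α * u| = α * t := by
      rw [← mul_sub, show Real.pi / 2 - u = -t by linarith, mul_neg, abs_neg,
        abs_of_nonneg (mul_nonneg hα.1.le ht0)]
    rw [h5] at this
    linarith [(abs_le.1 this).2]
  have hkey : Real.cos (α * (Real.pi / 2)) ≤ Real.cos (α * u) - v ^ (1 - α) * Real.cos u := by
    have hs0 : 0 ≤ Real.sin t := by linarith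
    have h6 : α * t ≤ t := mul_le_of_le_one_left ht0 hα.2.le
    rw [hcu]
    nlinarith
  have h7 : v * Real.cos u = v ^ α * (v ^ (1 - α) * Real.cos u) := by
    conv_lhs => rw [hv4]
    ring
  rw [h7]
  nlinarith

lemma norm_exp_delta_mul (α s : ℝ) (x : ℂ) :
    ‖exp (delta α * exp s) * x‖ = Real.exp (Real.exp s * delta α) * ‖x‖ := by
  rw [norm_mul, norm_exp, re_ofReal_mul, ← ofReal_exp, ofReal_re, mul_comm (delta α)]

/-- `e^{δx} G_α(x) → 0` as `x → +∞`: the ray is deformed into a contour through the saddle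
point, on which the real part of `ζ - ζ^α` attains its maximum `-δ` at the saddle point only. -/
theorem tendsto_logK_ofReal {α : ℝ} (hα : α ∈ Ioo (0 : ℝ) 1) :
    Tendsto (fun s : ℝ => logK α s) atTop (𝓝 0) := by
  have hπ := Real.pi_pos
  obtain ⟨R, hR, hneg⟩ := exists_second_quadrant_neg hα
  have hζ := saddlePoint_pos hα
  have hR0 : 0 < R := hζ.trans_le hR
  set ζ := saddlePoint α with hζdef
  set E : ℝ → ℂ := fun s => exp (delta α * exp s) with hE
  set a₁ : ℝ → ℝ → ℂ := fun s u => I * (ζ * exp (u * I) * saddleExp α (exp s) ζ u) with ha₁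
  set a₂ : ℝ → ℝ → ℂ := fun s v => exp ((Real.pi / 2 : ℝ) * I) *
    saddleExp α (exp s) v (Real.pi / 2) with ha₂
  set a₃ : ℝ → ℝ → ℂ := fun s u => I * (R * exp (u * I) * saddleExp α (exp s) R u) with ha₃
  set a₄ : ℝ → ℝ → ℂ := fun s v => exp ((Real.pi : ℝ) * I) * saddleExp α (exp s) v Real.pi with ha₄
  have t₁ : Tendsto (fun s => ∫ u in Ioc 0 (Real.pi / 2), E s * a₁ s u) atTop (𝓝 0) := by
    refine tendsto_integral_exp_decay (c := ζ)
      (h := fun u => ζ * Real.cos u - ζ ^ α * Real.cos (α * u) + delta α)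
      (fun s => (continuous_const.mul (continuous_arc hα.1 _ _)).aestronglyMeasurable)
      (fun s u => ?_) ((ae_restrict_mem measurableSet_Ioc).mono fun u hu =>
        arc_saddlePoint_neg hα hu.1 hu.2) ?_
    · simp only [hE, ha₁]
      rw [norm_exp_delta_mul, norm_arc α s hζ.le, mul_left_comm, ← Real.exp_add]
      simp only [ofReal_re, ofReal_im, add_zero]
      ring_nf
    · exact ((by fun_prop : Continuous fun u : ℝ => Real.exp (ζ * Real.cos u -
        ζ ^ α * Real.cos (α * u) + delta α)).integrableOn_Icc).mono_set Ioc_subset_Icc_self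
  have t₂ : Tendsto (fun s => ∫ v in Ioc ζ R, E s * a₂ s v) atTop (𝓝 0) := by
    refine tendsto_integral_exp_decay (c := 1)
      (h := fun v => v * Real.cos (Real.pi / 2) - v ^ α * Real.cos (α * (Real.pi / 2)) + delta α)
      (fun s => (continuous_const.mul (continuous_ray hα.1 _ _)).aestronglyMeasurable)
      (fun s v => ?_) ((ae_restrict_mem measurableSet_Ioc).mono fun v hv =>
        ray_pi_div_two_neg hα hv.1.le) ?_
    · simp only [hE, ha₂]
      rw [norm_exp_delta_mul, norm_exp_mul_saddleExp, ← Real.exp_add]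
      simp only [ofReal_re, ofReal_im, add_zero]
      ring_nf
    · have : Continuous fun v : ℝ => v ^ α := Real.continuous_rpow_const hα.1.le
      exact ((by fun_prop : Continuous fun v : ℝ => Real.exp (v * Real.cos (Real.pi / 2) -
        v ^ α * Real.cos (α * (Real.pi / 2)) + delta α)).integrableOn_Icc).mono_set
          Ioc_subset_Icc_self
  have t₃ : Tendsto (fun s => ∫ u in Ioc (Real.pi / 2) Real.pi, E s * a₃ s u) atTop (𝓝 0) := by
    refine tendsto_integral_exp_decay (c := R)
      (h := fun u => R * Real.cos u - R ^ α * Real.cos (α * u) + delta α)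
      (fun s => (continuous_const.mul (continuous_arc hα.1 _ _)).aestronglyMeasurable)
      (fun s u => ?_) ((ae_restrict_mem measurableSet_Ioc).mono fun u hu =>
        hneg R le_rfl u hu.1.le hu.2) ?_
    · simp only [hE, ha₃]
      rw [norm_exp_delta_mul, norm_arc α s hR0.le, mul_left_comm, ← Real.exp_add]
      simp only [ofReal_re, ofReal_im, add_zero]
      ring_nf
    · exact ((by fun_prop : Continuous fun u : ℝ => Real.exp (R * Real.cos u -
        R ^ α * Real.cos (α * u) + delta α)).integrableOn_Icc).mono_set Ioc_subset_Icc_self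
  have t₄ : Tendsto (fun s => ∫ v in Ioi R, E s * a₄ s v) atTop (𝓝 0) := by
    refine tendsto_integral_exp_decay (c := 1)
      (h := fun v => v * Real.cos Real.pi - v ^ α * Real.cos (α * Real.pi) + delta α)
      (fun s => (continuous_const.mul (continuous_ray hα.1 _ _)).aestronglyMeasurable)
      (fun s v => ?_) ((ae_restrict_mem measurableSet_Ioi).mono fun v hv =>
        hneg v (le_of_lt hv) Real.pi (by linarith) le_rfl) ?_
    · simp only [hE, ha₄]
      rw [norm_exp_delta_mul, norm_exp_mul_saddleExp, ← Real.exp_add]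
      simp only [ofReal_re, ofReal_im, add_zero]
      ring_nf
    · refine IntegrableOn.congr_fun (((integrableOn_exp_rpow_sub hα
        (-Real.cos (α * Real.pi))).mono_set (Ioi_subset_Ioi hR0.le)).const_mul
        (Real.exp (delta α))) (fun v _ => ?_) measurableSet_Ioi
      rw [← Real.exp_add, Real.cos_pi]
      ring_nf
  have hsum := ((t₁.add t₂).add t₃).add t₄
  simp only [add_zero] at hsum
  have him := (continuous_im.tendsto _).comp hsum
  rw [zero_im] at him
  have hlim := (continuous_ofReal.tendsto _).comp (him.div_const Real.pi)
  rw [zero_div, ofReal_zero] at hlim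
  refine hlim.congr' ?_
  filter_upwards [eventually_ge_atTop 0] with s hs
  -- the real segment from `0` to the saddle point contributes a real number
  have hint : IntegrableOn (a₄ s) (Ioi 0) := by
    have := integrableOn_ray hα (w := (s : ℂ)) (by simpa using hs) Real.cos_pi
    simpa only [ofReal_im, sub_zero] using this
  have r1 : ∀ u₀ u₁ b : ℝ, 0 < b → _ := fun u₀ u₁ b hb =>
    integral_saddleExp_rotate hα.1 (exp s) (b := b) hb u₀ u₁
  have i1 : ∀ a b : ℝ, IntervalIntegrable (a₂ s) volume a b := fun a b =>
    (continuous_ray hα.1 _ _).intervalIntegrable a b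
  have hsplit : ∫ v in Ioi (0 : ℝ), a₄ s v =
      (∫ v in (0 : ℝ)..ζ, exp ((0 : ℝ) * I) * saddleExp α (exp s) v 0) +
        (∫ u in Ioc 0 (Real.pi / 2), a₁ s u) + (∫ v in Ioc ζ R, a₂ s v) +
        (∫ u in Ioc (Real.pi / 2) Real.pi, a₃ s u) + ∫ v in Ioi R, a₄ s v := by
    rw [← intervalIntegral.integral_interval_add_Ioi hint
      (hint.mono_set (Ioi_subset_Ioi hR0.le)), r1 (Real.pi / 2) Real.pi R hR0,
      ← intervalIntegral.integral_add_adjacent_intervals (i1 0 ζ) (i1 ζ R),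
      r1 0 (Real.pi / 2) ζ hζ, intervalIntegral.integral_of_le (by linarith : (0 : ℝ) ≤ Real.pi / 2),
      intervalIntegral.integral_of_le hR,
      intervalIntegral.integral_of_le (by linarith : Real.pi / 2 ≤ Real.pi)]
  have hreal : (∫ v in (0 : ℝ)..ζ, exp ((0 : ℝ) * I) * saddleExp α (exp s) v 0).im = 0 := by
    have : ∀ v : ℝ, exp ((0 : ℝ) * I) * saddleExp α (exp s) v 0 =
        ((Real.exp (Real.exp s * (v - v ^ α)) : ℝ) : ℂ) := by
      intro v
      simp only [saddleExp, ofReal_zero, zero_mul, exp_zero, mul_zero, mul_one, one_mul]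
      push_cast
      rfl
    simp_rw [this]
    rw [intervalIntegral.integral_ofReal, ofReal_im]
  simp only [Function.comp_apply]
  have hEr : E s = ((Real.exp (delta α * Real.exp s) : ℝ) : ℂ) := by
    simp only [hE]; push_cast; rfl
  have hUim : (∫ v in Ioi (0 : ℝ), a₄ s v).im = ((∫ u in Ioc 0 (Real.pi / 2), a₁ s u) +
      (∫ v in Ioc ζ R, a₂ s v) + (∫ u in Ioc (Real.pi / 2) Real.pi, a₃ s u) +
      ∫ v in Ioi R, a₄ s v).im := by
    rw [hsplit, add_im, add_im, add_im, add_im, hreal, add_im, add_im, add_im]; ring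
  rw [integral_const_mul (E s), integral_const_mul (E s), integral_const_mul (E s),
    integral_const_mul (E s), ← mul_add,
    ← mul_add, ← mul_add, hEr, im_ofReal_mul, ← hUim, logK, logG_ofReal, ← ofReal_exp,
    ← ofReal_mul, ← ofReal_exp, ← ofReal_mul, mul_div_assoc, mul_comm]
  simp only [ha₄, ← ofReal_exp]

lemma exists_norm_logK_ofReal_le {α : ℝ} (hα : α ∈ Ioo (0 : ℝ) 1) :
    ∃ C : ℝ, ∀ s : ℝ, 0 ≤ s → ‖logK α s‖ ≤ C := by
  have hc : Continuous fun s : ℝ => logK α s :=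
    (differentiable_logK hα).continuous.comp continuous_ofReal
  obtain ⟨N, hN⟩ := eventually_atTop.1
    ((tendsto_logK_ofReal hα).norm.eventually_le_const (u := 1) (by simp))
  obtain ⟨C, hC⟩ := (isCompact_Icc (a := (0 : ℝ)) (b := N)).exists_bound_of_continuousOn
    hc.continuousOn
  refine ⟨max 1 C, fun s hs => ?_⟩
  rcases le_total N s with h | h
  · exact (hN s h).trans (le_max_left _ _)
  · exact (hC s ⟨hs, h⟩).trans (le_max_right _ _)

/-! ### The sign of the imaginary part -/

lemma re_expRpowIntegral_lt {α : ℝ} (hα : α ∈ Ioo (0 : ℝ) 1) {u : ℂ} {c : ℝ} (hu : -c < u.re) :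
    (expRpowIntegral α u).re < (expRpowIntegral α (-c)).re := by
  have h1 : ∀ v : ℂ, (expRpowIntegral α v).re =
      ∫ y in Ioi (0 : ℝ), (exp (-(v * ((y ^ α : ℝ) : ℂ)) - (y : ℂ))).re := fun v =>
    (reCLM.integral_comp_comm (integrableOn_expRpow hα v)).symm
  have hre : ∀ v : ℂ, IntegrableOn (fun y : ℝ => (exp (-(v * ((y ^ α : ℝ) : ℂ)) - (y : ℂ))).re)
      (Ioi 0) := fun v => reCLM.integrable_comp (integrableOn_expRpow hα v)
  have hpos : ∀ y ∈ Ioi (0 : ℝ), 0 < (exp (-(-(c : ℂ) * ((y ^ α : ℝ) : ℂ)) - (y : ℂ))).re -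
      (exp (-(u * ((y ^ α : ℝ) : ℂ)) - (y : ℂ))).re := by
    intro y hy
    have hyα : 0 < y ^ α := Real.rpow_pos_of_pos hy α
    have e1 : exp (-(-(c : ℂ) * ((y ^ α : ℝ) : ℂ)) - (y : ℂ)) =
        ((Real.exp (c * y ^ α - y) : ℝ) : ℂ) := by push_cast; ring_nf
    have e2 := re_le_norm (exp (-(u * ((y ^ α : ℝ) : ℂ)) - (y : ℂ)))
    rw [norm_expRpow] at e2
    rw [e1, ofReal_re]
    have : Real.exp (-u.re * y ^ α - y) < Real.exp (c * y ^ α - y) :=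
      Real.exp_lt_exp.2 (by nlinarith)
    linarith
  rw [← sub_pos, h1, h1, ← integral_sub (hre _) (hre _),
    setIntegral_pos_iff_support_of_nonneg_ae
      ((ae_restrict_mem measurableSet_Ioi).mono fun y hy => (hpos y hy).le)
      ((hre _).sub (hre _))]
  have : Ioi (0 : ℝ) ⊆ Function.support (fun y : ℝ =>
      (exp (-(-(c : ℂ) * ((y ^ α : ℝ) : ℂ)) - (y : ℂ))).re -
        (exp (-(u * ((y ^ α : ℝ) : ℂ)) - (y : ℂ))).re) ∩ Ioi 0 :=
    fun y hy => ⟨(hpos y hy).ne', hy⟩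
  exact lt_of_lt_of_le (by simp) (measure_mono this)

/-- On the upper side of the cut, the imaginary part of `G_α` is negative, because
`Re e^{u} < e^{|u|}` unless `u > 0`. -/
lemma im_logG_pi_neg {α : ℝ} (hα : α ∈ Ioo (0 : ℝ) 1) (s : ℝ) :
    (logG α (s + Real.pi * I)).im < 0 := by
  have hπ := Real.pi_pos
  set c : ℝ := Real.exp ((1 - α) * s) with hc
  have hc0 : 0 < c := Real.exp_pos _
  have e1 : exp ((1 - α) * (s + Real.pi * I) + α * ((Real.pi : ℝ) * I)) = -(c : ℂ) := by
    have : (1 - (α : ℂ)) * (s + Real.pi * I) + α * ((Real.pi : ℝ) * I) =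
        (((1 - α) * s : ℝ) : ℂ) + Real.pi * I := by push_cast; ring
    rw [this, exp_add, exp_pi_mul_I, ← ofReal_exp]; ring
  set u : ℂ := exp ((1 - α) * (s + Real.pi * I) + α * ((-Real.pi : ℝ) * I)) with hu
  have e2 : u.re = c * Real.cos ((1 - 2 * α) * Real.pi) := by
    have : (1 - (α : ℂ)) * (s + Real.pi * I) + α * ((-Real.pi : ℝ) * I) =
        (((1 - α) * s : ℝ) : ℂ) + ((((1 - 2 * α) * Real.pi : ℝ)) : ℂ) * I := by push_cast; ring
    rw [hu, this, exp_add, ← ofReal_exp, re_ofReal_mul, exp_ofReal_mul_I_re]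
  have e3 : -1 < Real.cos ((1 - 2 * α) * Real.pi) := by
    rw [← Real.cos_pi, ← Real.cos_abs ((1 - 2 * α) * Real.pi)]
    refine Real.cos_lt_cos_of_nonneg_of_le_pi (abs_nonneg _) le_rfl ?_
    rw [abs_lt]; constructor <;> nlinarith [hα.1, hα.2]
  have hlt := re_expRpowIntegral_lt hα (u := u) (c := c) (by rw [e2]; nlinarith)
  have e4 : exp (-((s : ℂ) + Real.pi * I)) = ((-Real.exp (-s) : ℝ) : ℂ) := by
    rw [neg_add, exp_add, exp_neg (Real.pi * I), exp_pi_mul_I]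
    push_cast
    norm_num
  have e5 : logG α (s + Real.pi * I) = (((Real.exp (-s) / (2 * Real.pi) : ℝ)) : ℂ) *
      (I * (expRpowIntegral α u - expRpowIntegral α (-(c : ℂ)))) := by
    rw [logG, e1, ← hu, e4]
    clear_value u
    have hπ' : (Real.pi : ℂ) ≠ 0 := ofReal_ne_zero.2 hπ.ne'
    push_cast
    field_simp
    rw [I_sq]; ring
  rw [e5, im_ofReal_mul, I_mul_im, sub_re]
  exact mul_neg_of_pos_of_neg (by positivity) (by linarith)

lemma exp_add_pi_mul_I (s : ℝ) : exp ((s : ℂ) + Real.pi * I) = ((-Real.exp s : ℝ) : ℂ) := by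
  rw [exp_add, exp_pi_mul_I]; push_cast; ring

lemma logK_pi (α s : ℝ) : logK α (s + Real.pi * I) =
    ((Real.exp (-(delta α * Real.exp s)) : ℝ) : ℂ) * logG α (s + Real.pi * I) := by
  rw [logK, exp_add_pi_mul_I, ← ofReal_mul, ← ofReal_exp, mul_comm, mul_neg]

lemma im_logK_pi_neg {α : ℝ} (hα : α ∈ Ioo (0 : ℝ) 1) (s : ℝ) :
    (logK α (s + Real.pi * I)).im < 0 := by
  rw [logK_pi, im_ofReal_mul]
  exact mul_neg_of_pos_of_neg (Real.exp_pos _) (im_logG_pi_neg hα s)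

lemma exists_norm_logK_le_rpow {α : ℝ} (hα : α ∈ Ioo (0 : ℝ) 1) :
    ∃ C : ℝ, 0 ≤ C ∧ ∀ w : ℂ, w.re ≤ 0 → ‖logK α w‖ ≤ C * Real.exp (-α * w.re) := by
  obtain ⟨C, hC⟩ := exists_norm_logG_le_rpow hα
  have hδ := delta_pos hα
  have hC0 : 0 ≤ C := by simpa using (norm_nonneg _).trans (hC 0 (by simp))
  refine ⟨C * Real.exp (delta α), by positivity, fun w hw => ?_⟩
  have h1 : Real.exp w.re * Real.cos w.im ≤ 1 := by
    nlinarith [Real.exp_le_one_iff.2 hw, Real.cos_le_one w.im, Real.exp_pos w.re]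
  have h2 : Real.exp (delta α * (Real.exp w.re * Real.cos w.im)) ≤ Real.exp (delta α) :=
    Real.exp_le_exp.2 (by nlinarith)
  rw [norm_logK]
  calc _ ≤ (C * Real.exp (-α * w.re)) * Real.exp (delta α) :=
        mul_le_mul (hC w hw) h2 (Real.exp_pos _).le (by positivity)
    _ = _ := by ring

/-- `e^{δz} G_α(z)` is of exponential type, which the Phragmén-Lindelöf principle requires in
sectors of opening less than `π`. -/
lemma exists_norm_logK_le_exp_exp {α : ℝ} (hα : α ∈ Ioo (0 : ℝ) 1) :
    ∃ C B : ℝ, ∀ w : ℂ, ‖logK α w‖ ≤ C * Real.exp (B * Real.exp (1 * |w.re|)) := by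
  obtain ⟨C₁, hC₁0, hC₁⟩ := exists_norm_logK_le_rpow hα
  obtain ⟨C₂, hC₂⟩ := exists_norm_logG_le_exp hα
  have hδ := delta_pos hα
  have hC₂0 : 0 ≤ C₂ :=
    nonneg_of_mul_nonneg_left ((norm_nonneg _).trans (hC₂ 0 (by simp))) (Real.exp_pos _)
  refine ⟨max C₁ C₂, 2 * delta α + 1, fun w => ?_⟩
  rw [one_mul]
  have hE : |w.re| + 1 ≤ Real.exp |w.re| := Real.add_one_le_exp _
  have hE0 : 0 < Real.exp |w.re| := Real.exp_pos _
  rcases le_total w.re 0 with h | h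
  · refine (hC₁ w h).trans (mul_le_mul (le_max_left _ _) (Real.exp_le_exp.2 ?_)
      (Real.exp_pos _).le (hC₁0.trans (le_max_left _ _)))
    rw [abs_of_nonpos h] at *
    nlinarith [hα.2]
  · rw [norm_logK, abs_of_nonneg h] at *
    calc _ ≤ (C₂ * Real.exp (delta α * Real.exp w.re)) * Real.exp (delta α * Real.exp w.re) := by
          refine mul_le_mul (hC₂ w h) (Real.exp_le_exp.2 ?_) (Real.exp_pos _).le (by positivity)
          refine mul_le_mul_of_nonneg_left ?_ hδ.le
          nlinarith [Real.cos_le_one w.im]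
      _ = C₂ * Real.exp (2 * delta α * Real.exp w.re) := by
          rw [mul_assoc, ← Real.exp_add]; ring_nf
      _ ≤ _ := by
          refine mul_le_mul (le_max_right _ _) (Real.exp_le_exp.2 ?_) (Real.exp_pos _).le
            (hC₂0.trans (le_max_right _ _))
          nlinarith

lemma closure_im_preimage_Ioo_subset (a b : ℝ) :
    closure (im ⁻¹' Ioo a b) ⊆ {w : ℂ | a ≤ w.im ∧ w.im ≤ b} :=
  closure_minimal (fun _ hw => ⟨hw.1.le, hw.2.le⟩)
    ((isClosed_le continuous_const continuous_im).inter
      (isClosed_le continuous_im continuous_const))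

lemma one_le_norm_add_I {z : ℂ} (hz : 0 ≤ z.im) : 1 ≤ ‖z + I‖ := by
  refine le_trans ?_ (abs_im_le_norm (z + I))
  rw [add_im, I_im, abs_of_nonneg (by linarith)]; linarith

lemma norm_le_norm_add_I {z : ℂ} (hz : 0 ≤ z.im) : ‖z‖ ≤ ‖z + I‖ := by
  rw [← sq_le_sq₀ (norm_nonneg _) (norm_nonneg _), ← normSq_eq_norm_sq, ← normSq_eq_norm_sq,
    normSq_apply, normSq_apply]
  simp only [add_re, add_im, I_re, I_im]
  nlinarith

lemma exp_im_nonneg {w : ℂ} (h0 : 0 ≤ w.im) (hπ : w.im ≤ Real.pi) : 0 ≤ (exp w).im := by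
  rw [exp_im]
  exact mul_nonneg (Real.exp_pos _).le (Real.sin_nonneg_of_nonneg_of_le_pi h0 hπ)

/-- Phragmén-Lindelöf in a substrip: a bound of `e^{δz} G_α(z)` for `|z| ≥ 1` carries over from
two rays to the sector between them, whose opening is less than `π`. -/
lemma exists_norm_logK_le_of_lines {α : ℝ} (hα : α ∈ Ioo (0 : ℝ) 1) {a b : ℝ} (ha : 0 ≤ a)
    (hab : a < b) (hb : b ≤ Real.pi) (hab' : b - a < Real.pi) {C : ℝ}
    (hCa : ∀ w : ℂ, w.im = a → 0 ≤ w.re → ‖logK α w‖ ≤ C)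
    (hCb : ∀ w : ℂ, w.im = b → 0 ≤ w.re → ‖logK α w‖ ≤ C) :
    ∃ C' : ℝ, ∀ w : ℂ, a ≤ w.im → w.im ≤ b → 0 ≤ w.re → ‖logK α w‖ ≤ C' := by
  obtain ⟨C₁, hC₁0, hC₁⟩ := exists_norm_logK_le_rpow hα
  obtain ⟨C₂, B, hC₂⟩ := exists_norm_logK_le_exp_exp hα
  -- the factor `z / (z + i)` cancels the singularity at the origin
  set f : ℂ → ℂ := fun w => logK α w * (exp w / (exp w + I)) with hf
  have hfac1 : ∀ w : ℂ, a ≤ w.im → w.im ≤ b → ‖exp w / (exp w + I)‖ ≤ 1 := by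
    intro w h1 h2
    have him := exp_im_nonneg (ha.trans h1) (h2.trans hb)
    rw [norm_div]
    exact div_le_one_of_le₀ (norm_le_norm_add_I him) (norm_nonneg _)
  have hfac2 : ∀ w : ℂ, a ≤ w.im → w.im ≤ b → ‖exp w / (exp w + I)‖ ≤ Real.exp w.re := by
    intro w h1 h2
    have him := exp_im_nonneg (ha.trans h1) (h2.trans hb)
    rw [norm_div, norm_exp]
    exact div_le_self (Real.exp_pos _).le (one_le_norm_add_I him)
  have hline : ∀ t : ℝ, a ≤ t → t ≤ b → (∀ w : ℂ, w.im = t → 0 ≤ w.re → ‖logK α w‖ ≤ C) →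
      ∀ w : ℂ, w.im = t → ‖f w‖ ≤ max C C₁ := by
    intro t h1 h2 h w hw
    simp only [hf]
    rw [norm_mul]
    rcases le_total 0 w.re with hr | hr
    · refine ((mul_le_of_le_one_right (norm_nonneg _) (hfac1 w (hw ▸ h1) (hw ▸ h2))).trans
        (h w hw hr)).trans (le_max_left _ _)
    · refine le_trans ?_ (le_max_right _ _)
      calc _ ≤ (C₁ * Real.exp (-α * w.re)) * Real.exp w.re :=
            mul_le_mul (hC₁ w hr) (hfac2 w (hw ▸ h1) (hw ▸ h2)) (norm_nonneg _) (by positivity)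
        _ = C₁ * Real.exp ((1 - α) * w.re) := by rw [mul_assoc, ← Real.exp_add]; ring_nf
        _ ≤ C₁ := mul_le_of_le_one_right hC₁0
            (Real.exp_le_one_iff.2 (mul_nonpos_of_nonneg_of_nonpos (by linarith [hα.2]) hr))
  have hne : ∀ w : ℂ, a ≤ w.im → w.im ≤ b → exp w + I ≠ 0 := by
    intro w h1 h2 h0
    have := one_le_norm_add_I (exp_im_nonneg (ha.trans h1) (h2.trans hb))
    rw [h0, norm_zero] at this
    linarith
  have hd : DiffContOnCl ℂ f (im ⁻¹' Ioo a b) := by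
    refine DifferentiableOn.diffContOnCl fun w hw => ?_
    have hw' := closure_im_preimage_Ioo_subset a b hw
    exact ((differentiable_logK hα w).mul ((differentiable_exp w).div
      ((differentiable_exp w).add_const I) (hne w hw'.1 hw'.2))).differentiableWithinAt
  have hgrowth : ∃ c < Real.pi / (b - a), ∃ B,
      f =O[comap (_root_.abs ∘ re) atTop ⊓ 𝓟 (im ⁻¹' Ioo a b)]
        fun z ↦ Real.exp (B * Real.exp (c * |z.re|)) := by
    refine ⟨1, by rw [lt_div_iff₀ (by linarith)]; linarith, B, Asymptotics.IsBigO.of_bound C₂ ?_⟩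
    refine mem_inf_of_right fun w hw => ?_
    simp only [mem_ofPred_eq, hf]
    rw [norm_mul, Real.norm_of_nonneg (Real.exp_pos _).le]
    exact (mul_le_of_le_one_right (norm_nonneg _) (hfac1 w hw.1.le hw.2.le)).trans (hC₂ w)
  refine ⟨max C C₁ * 2, fun w h1 h2 hr => ?_⟩
  have hle := PhragmenLindelof.horizontal_strip hd hgrowth (hline a le_rfl hab.le hCa)
    (hline b hab.le le_rfl hCb) h1 h2
  have hlow : ‖exp w + I‖ ≤ 2 * ‖exp w‖ := by
    refine (norm_add_le _ _).trans ?_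
    rw [norm_I, norm_exp]; linarith [Real.one_le_exp hr]
  have heq : logK α w = f w * ((exp w + I) / exp w) := by
    simp only [hf]
    field_simp [hne w h1 h2, exp_ne_zero w]
  rw [heq, norm_mul, norm_div]
  refine mul_le_mul hle ?_ (by positivity) ((norm_nonneg _).trans hle)
  rw [div_le_iff₀ (norm_pos_iff.2 (exp_ne_zero w))]
  exact hlow

/-- `e^{δz} G_α(z)` is bounded on the part of the closed upper half-plane outside the unit
disc. -/
theorem exists_norm_logK_le {α : ℝ} (hα : α ∈ Ioo (0 : ℝ) 1) :
    ∃ C : ℝ, ∀ w : ℂ, 0 ≤ w.im → w.im ≤ Real.pi → 0 ≤ w.re → ‖logK α w‖ ≤ C := by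
  have hπ := Real.pi_pos
  obtain ⟨C₀, h₀⟩ := exists_norm_logK_ofReal_le hα
  obtain ⟨C₁, h₁⟩ := exists_norm_logG_imaginary_le hα
  obtain ⟨C₂, h₂⟩ := exists_norm_logG_le_exp hα
  have g₀ : ∀ w : ℂ, w.im = 0 → 0 ≤ w.re → ‖logK α w‖ ≤ C₀ := by
    intro w hw hr
    have : w = (w.re : ℂ) := by apply Complex.ext <;> simp [hw]
    rw [this]; exact h₀ _ hr
  have g₁ : ∀ w : ℂ, w.im = Real.pi / 2 → 0 ≤ w.re → ‖logK α w‖ ≤ C₁ := by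
    intro w hw hr
    rw [norm_logK, hw, Real.cos_pi_div_two, mul_zero, mul_zero, Real.exp_zero, mul_one]
    exact h₁ w hr hw
  have g₂ : ∀ w : ℂ, w.im = Real.pi → 0 ≤ w.re → ‖logK α w‖ ≤ C₂ := by
    intro w hw hr
    rw [norm_logK, hw, Real.cos_pi]
    refine (mul_le_mul_of_nonneg_right (h₂ w hr) (Real.exp_pos _).le).trans_eq ?_
    rw [mul_assoc, ← Real.exp_add]
    ring_nf
    simp
  set C := max C₀ (max C₁ C₂)
  have hC₀ : C₀ ≤ C := le_max_left _ _
  have hC₁ : C₁ ≤ C := (le_max_left _ _).trans (le_max_right _ _)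
  have hC₂ : C₂ ≤ C := (le_max_right _ _).trans (le_max_right _ _)
  obtain ⟨A, hA⟩ := exists_norm_logK_le_of_lines hα (a := 0) (b := Real.pi / 2) le_rfl
    (by linarith) (by linarith) (by linarith) (C := C)
    (fun w h h' => (g₀ w h h').trans hC₀) (fun w h h' => (g₁ w h h').trans hC₁)
  obtain ⟨B, hB⟩ := exists_norm_logK_le_of_lines hα (a := Real.pi / 2) (b := Real.pi)
    (by linarith) (by linarith) le_rfl (by linarith) (C := C)
    (fun w h h' => (g₁ w h h').trans hC₁) (fun w h h' => (g₂ w h h').trans hC₂)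
  refine ⟨max A B, fun w h1 h2 hr => ?_⟩
  rcases le_total w.im (Real.pi / 2) with h | h
  · exact (hA w h1 h hr).trans (le_max_left _ _)
  · exact (hB w h h2 hr).trans (le_max_right _ _)

/-- `e^{δz} G_α(z)` has a nonpositive imaginary part in the closed upper half-plane: this is the
Phragmén-Lindelöf principle for `exp (-i e^{δz} G_α(z))`. -/
theorem im_logK_nonpos {α : ℝ} (hα : α ∈ Ioo (0 : ℝ) 1) {w : ℂ} (h0 : 0 ≤ w.im)
    (hπ : w.im ≤ Real.pi) : (logK α w).im ≤ 0 := by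
  obtain ⟨C₁, hC₁0, hC₁⟩ := exists_norm_logK_le_rpow hα
  obtain ⟨C₂, hC₂⟩ := exists_norm_logK_le hα
  have hnorm : ∀ w, ‖exp (-I * logK α w)‖ = Real.exp (logK α w).im := by
    intro w
    rw [norm_exp]; simp
  have hC₂0 : 0 ≤ C₂ := (norm_nonneg _).trans (hC₂ 0 (by simp) (by simp [Real.pi_pos.le]) (by simp))
  have hgrowth : ∃ c < Real.pi / (Real.pi - 0), ∃ B,
      (fun w => exp (-I * logK α w)) =O[comap (_root_.abs ∘ re) atTop ⊓ 𝓟 (im ⁻¹' Ioo 0 Real.pi)]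
        fun z ↦ Real.exp (B * Real.exp (c * |z.re|)) := by
    refine ⟨α, by rw [sub_zero, div_self Real.pi_ne_zero]; exact hα.2, C₁ + C₂,
      Asymptotics.IsBigO.of_bound 1 (mem_inf_of_right fun w hw => ?_)⟩
    simp only [mem_ofPred_eq]
    rw [hnorm, one_mul, Real.norm_of_nonneg (Real.exp_pos _).le, Real.exp_le_exp]
    refine ((le_abs_self _).trans (abs_im_le_norm _)).trans ?_
    have h1 : 1 ≤ Real.exp (α * |w.re|) := Real.one_le_exp (mul_nonneg hα.1.le (abs_nonneg _))
    rcases le_total w.re 0 with h | h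
    · have := hC₁ w h
      rw [abs_of_nonpos h, mul_neg, ← neg_mul] at *
      nlinarith
    · have := hC₂ w hw.1.le hw.2.le h
      nlinarith
  have hle : ‖exp (-I * logK α w)‖ ≤ 1 := by
    refine PhragmenLindelof.horizontal_strip (f := fun w => exp (-I * logK α w))
      (((differentiable_logK hα).const_mul _).cexp.diffContOnCl) hgrowth ?_ ?_ h0 hπ
    · intro z hz
      have : z = (z.re : ℂ) := by apply Complex.ext <;> simp [hz]
      rw [hnorm, this, logK_ofReal_im, Real.exp_zero]
    · intro z hz
      have : z = (z.re : ℂ) + Real.pi * I := by apply Complex.ext <;> simp [hz]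
      rw [hnorm, this, Real.exp_le_one_iff]
      exact (im_logK_pi_neg hα _).le
  rwa [hnorm, Real.exp_le_one_iff] at hle

lemma strip_nonempty : ((Real.pi / 2 : ℝ) * I : ℂ) ∈ strip := by
  constructor <;> simp <;> linarith [Real.pi_pos]

lemma mem_closure_strip {w : ℂ} (h0 : 0 ≤ w.im) (hπ : w.im ≤ Real.pi) : w ∈ closure strip := by
  have h1 : w ∈ im ⁻¹' closure (Ioo 0 Real.pi) := by
    rw [closure_Ioo Real.pi_ne_zero.symm]; exact ⟨h0, hπ⟩
  rwa [← closure_preimage_im] at h1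

theorem im_logK_neg {α : ℝ} (hα : α ∈ Ioo (0 : ℝ) 1) {w : ℂ} (hw : w ∈ strip) :
    (logK α w).im < 0 := by
  refine lt_of_le_of_ne (im_logK_nonpos hα hw.1.le hw.2.le) fun h => ?_
  have hnorm : ∀ w, ‖exp (-I * logK α w)‖ = Real.exp (logK α w).im := by
    intro w
    rw [norm_exp]; simp
  have hd : Differentiable ℂ fun w => exp (-I * logK α w) :=
    ((differentiable_logK hα).const_mul _).cexp
  have hmax : IsMaxOn (norm ∘ fun w => exp (-I * logK α w)) strip w := by
    intro z hz
    simp only [mem_ofPred_eq, Function.comp_apply]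
    rw [hnorm, hnorm, h, Real.exp_le_exp]
    exact im_logK_nonpos hα hz.1.le hz.2.le
  have := norm_eqOn_closure_of_isPreconnected_of_isMaxOn convex_strip.isPreconnected isOpen_strip
    hd.diffContOnCl hw hmax (mem_closure_strip (w := (0 : ℝ) + Real.pi * I)
      (by simp [Real.pi_pos.le]) (by simp))
  simp only [Function.comp_apply, Function.const_apply] at this
  rw [hnorm, hnorm, h, Real.exp_eq_exp] at this
  exact (im_logK_pi_neg hα 0).ne this

/-- `e^{δx} G_α(x)` is nonincreasing on the positive axis: by the Cauchy-Riemann equations this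
expresses the sign of the imaginary part in the upper half-plane. -/
lemma antitone_logK_re {α : ℝ} (hα : α ∈ Ioo (0 : ℝ) 1) :
    Antitone fun s : ℝ => (logK α s).re := by
  have hd : ∀ s : ℝ, HasDerivAt (logK α) (deriv (logK α) s) s := fun s =>
    (differentiable_logK hα s).hasDerivAt
  have hre : ∀ s : ℝ, HasDerivAt (fun s : ℝ => (logK α s).re) (deriv (logK α) s).re s := fun s =>
    (hd s).real_of_complex
  refine antitone_of_deriv_nonpos (fun s => (hre s).differentiableAt) fun s => ?_
  rw [(hre s).deriv]
  have him : HasDerivAt (fun y : ℝ => (logK α ((s : ℂ) + y * I)).im) (deriv (logK α) s).re 0 := by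
    have h1 : HasDerivAt (fun y : ℝ => (s : ℂ) + y * I) I 0 := by
      simpa using ((hasDerivAt_id (0 : ℝ)).ofReal_comp.mul_const I).const_add (s : ℂ)
    have h2 : HasDerivAt (logK α) (deriv (logK α) s) ((s : ℂ) + (0 : ℝ) * I) := by
      simpa using hd s
    have h3 := h2.comp (0 : ℝ) h1
    have h4 := imCLM.hasFDerivAt.comp_hasDerivAt (0 : ℝ) h3
    refine h4.congr_deriv ?_
    simp
  refine le_of_tendsto him.tendsto_slope_zero_right ?_
  filter_upwards [Ioo_mem_nhdsGT Real.pi_pos] with y hy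
  have h1 : (logK α ((s : ℂ) + (y : ℝ) * I)).im ≤ 0 :=
    im_logK_nonpos hα (by simp [hy.1.le]) (by simp [hy.2.le])
  simp only [zero_add, ofReal_zero, zero_mul, add_zero, logK_ofReal_im, sub_zero, smul_eq_mul]
  exact mul_nonpos_of_nonneg_of_nonpos (inv_nonneg.2 hy.1.le) h1

theorem logK_re_pos {α : ℝ} (hα : α ∈ Ioo (0 : ℝ) 1) (s : ℝ) : 0 < (logK α s).re := by
  have hlim : Tendsto (fun s : ℝ => (logK α s).re) atTop (𝓝 0) :=
    (continuous_re.tendsto' 0 0 zero_re).comp (tendsto_logK_ofReal hα)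
  have hnn := fun s => (antitone_logK_re hα).le_of_tendsto hlim s
  refine lt_of_le_of_ne (hnn s) fun h => ?_
  -- otherwise the function vanishes on `[s, ∞)`, hence everywhere
  have hz : ∀ t : ℝ, s ≤ t → logK α t = 0 := by
    intro t ht
    apply Complex.ext
    · exact le_antisymm ((antitone_logK_re hα ht).trans h.symm.le) (hnn t)
    · exact logK_ofReal_im t
  have han : AnalyticOnNhd ℂ (logK α) univ :=
    (differentiable_logK hα).differentiableOn.analyticOnNhd isOpen_univ
  have htend : Tendsto (fun t : ℝ => (t : ℂ)) (𝓝[>] s) (𝓝[≠] (s : ℂ)) := by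
    refine tendsto_nhdsWithin_iff.2 ⟨(continuous_ofReal.tendsto s).mono_left nhdsWithin_le_nhds, ?_⟩
    filter_upwards [self_mem_nhdsWithin] with t ht
    simpa using (ne_of_gt ht)
  have hfreq : ∃ᶠ z in 𝓝[≠] (s : ℂ), logK α z = 0 := by
    refine htend.frequently (Eventually.frequently ?_)
    filter_upwards [self_mem_nhdsWithin] with t ht using hz t (le_of_lt ht)
  have := han.eqOn_zero_of_preconnected_of_frequently_eq_zero isPreconnected_univ (mem_univ _)
    hfreq (mem_univ ((0 : ℝ) + Real.pi * I : ℂ))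
  have h0 := im_logK_pi_neg hα 0
  rw [this] at h0
  simp at h0

/-! ### The integral of the angle -/

lemma exists_mul_one_add_le_norm_add {z : ℂ} (hz : z ∈ slitPlane) :
    ∃ c > 0, ∀ t : ℝ, 0 ≤ t → c * (1 + t) ≤ ‖z + t‖ := by
  rcases hz with hz | hz
  · refine ⟨min 1 z.re, lt_min one_pos hz, fun t ht => ?_⟩
    have h1 : z.re + t ≤ ‖z + t‖ := by simpa using re_le_norm (z + t)
    have h2 := min_le_left 1 z.re
    have h3 := min_le_right 1 z.re
    nlinarith
  · have hm : 0 < |z.im| := abs_pos.2 hz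
    have hc : 0 < (1 + ‖z‖) / |z.im| + 1 := by positivity
    refine ⟨((1 + ‖z‖) / |z.im| + 1)⁻¹, inv_pos.2 hc, fun t ht => ?_⟩
    rw [inv_mul_le_iff₀ hc]
    have h1 : |z.im| ≤ ‖z + t‖ := by simpa using abs_im_le_norm (z + t)
    have h2 : t ≤ ‖z‖ + ‖z + t‖ := by
      have := norm_sub_le (z + t) z
      rw [add_sub_cancel_left, norm_real, Real.norm_of_nonneg ht] at this
      linarith
    have h3 : 1 + ‖z‖ ≤ (1 + ‖z‖) / |z.im| * ‖z + t‖ := by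
      rw [div_mul_eq_mul_div, le_div_iff₀ hm]
      exact mul_le_mul_of_nonneg_left h1 (by positivity)
    linarith

/-- The exponent of the integral representation. In the upper half-plane its imaginary part is `-π`
times the Poisson integral of the function equal to `θ(t)` at `-t < 0` and to `0` on the positive
axis. -/
noncomputable def thorinIntegral (θ : ℝ → ℝ) (z : ℂ) : ℂ :=
  ∫ t in Ioi (0 : ℝ), (1 / (z + (t : ℂ)) - 1 / (1 + (t : ℂ))) * (θ t : ℂ)

lemma measurable_thorin {θ : ℝ → ℝ} (hm : Measurable θ) (z : ℂ) :
    Measurable fun t : ℝ => (1 / (z + (t : ℂ)) - 1 / (1 + (t : ℂ))) * (θ t : ℂ) := by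
  fun_prop

lemma inv_sq_le {c t N : ℝ} (hc : 0 < c) (ht : 0 ≤ t) (hN : c * (1 + t) ≤ N) :
    (N ^ 2)⁻¹ ≤ (c ^ 2)⁻¹ * (1 + t ^ 2)⁻¹ := by
  rw [← mul_inv]
  have h1 : c ^ 2 * (1 + t ^ 2) ≤ (c * (1 + t)) ^ 2 := by
    rw [mul_pow]; nlinarith [sq_nonneg c, mul_nonneg (sq_nonneg c) ht]
  exact inv_anti₀ (by positivity) (h1.trans (pow_le_pow_left₀ (by positivity) hN 2))

lemma integrableOn_thorin {θ : ℝ → ℝ} (hm : Measurable θ) (hθ : ∀ t, 0 < t → |θ t| ≤ 1) {z : ℂ}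
    (hz : z ∈ slitPlane) :
    IntegrableOn (fun t : ℝ => (1 / (z + (t : ℂ)) - 1 / (1 + (t : ℂ))) * (θ t : ℂ)) (Ioi 0) := by
  obtain ⟨c, hc, hcz⟩ := exists_mul_one_add_le_norm_add hz
  refine ((integrable_inv_one_add_sq.integrableOn (s := Ioi 0)).const_mul (‖1 - z‖ * c⁻¹)).mono'
    (measurable_thorin hm z).aestronglyMeasurable
    ((ae_restrict_mem measurableSet_Ioi).mono fun t ht => ?_)
  have ht0 : 0 < t := ht
  have h1 := hcz t ht0.le
  have hz1 : 0 < ‖z + t‖ := lt_of_lt_of_le (by positivity) h1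
  have h2 : ‖(1 : ℂ) + t‖ = 1 + t := by
    rw [← ofReal_one, ← ofReal_add, norm_real, Real.norm_of_nonneg (by positivity)]
  have h3 : (1 : ℂ) + t ≠ 0 := by rw [← norm_pos_iff, h2]; positivity
  have h4 : 1 / (z + (t : ℂ)) - 1 / (1 + (t : ℂ)) = (1 - z) / ((z + t) * (1 + t)) := by
    rw [div_sub_div _ _ (norm_pos_iff.1 hz1) h3]; ring
  rw [norm_mul, norm_real, h4, norm_div, norm_mul, h2]
  have h5 : (‖z + t‖ * (1 + t))⁻¹ ≤ c⁻¹ * (1 + t ^ 2)⁻¹ := by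
    rw [← mul_inv]
    refine inv_anti₀ (by positivity) ?_
    nlinarith [mul_le_mul_of_nonneg_right h1 (by positivity : 0 ≤ 1 + t), mul_nonneg hc.le ht0.le]
  calc _ ≤ ‖1 - z‖ / (‖z + t‖ * (1 + t)) := mul_le_of_le_one_right (by positivity) (hθ t ht0)
    _ ≤ _ := by
      rw [div_eq_mul_inv, mul_assoc]
      exact mul_le_mul_of_nonneg_left h5 (norm_nonneg _)

lemma differentiableOn_thorinIntegral {θ : ℝ → ℝ} (hm : Measurable θ)
    (hθ : ∀ t, 0 < t → |θ t| ≤ 1) : DifferentiableOn ℂ (thorinIntegral θ) slitPlane := by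
  intro z hz
  obtain ⟨c, hc, hcz⟩ := exists_mul_one_add_le_norm_add hz
  have hball : ∀ x ∈ Metric.ball z (c / 2), ∀ t : ℝ, 0 ≤ t → c / 2 * (1 + t) ≤ ‖x + t‖ := by
    intro x hx t ht
    have h1 := hcz t ht
    have h2 : ‖z - x‖ < c / 2 := by rw [← dist_eq_norm, dist_comm]; exact hx
    have h3 : ‖z + t‖ ≤ ‖x + t‖ + ‖z - x‖ := by
      have := norm_add_le (x + t) (z - x)
      rwa [show x + t + (z - x) = z + t by ring] at this
    nlinarith
  refine (hasDerivAt_integral_of_dominated_loc_of_deriv_le (μ := volume.restrict (Ioi (0 : ℝ)))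
    (F := fun (z : ℂ) (t : ℝ) => (1 / (z + (t : ℂ)) - 1 / (1 + (t : ℂ))) * (θ t : ℂ))
    (F' := fun (z : ℂ) (t : ℝ) => -1 / (z + (t : ℂ)) ^ 2 * (θ t : ℂ))
    (bound := fun t => ((c / 2) ^ 2)⁻¹ * (1 + t ^ 2)⁻¹)
    (Metric.ball_mem_nhds z (half_pos hc))
    (Eventually.of_forall fun z => (measurable_thorin hm z).aestronglyMeasurable)
    (integrableOn_thorin hm hθ hz) (by fun_prop) ?_
    ((integrable_inv_one_add_sq.integrableOn (s := Ioi 0)).const_mul _)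
    ?_).2.differentiableAt.differentiableWithinAt
  · refine (ae_restrict_mem measurableSet_Ioi).mono fun t ht x hx => ?_
    rw [norm_mul, norm_div, norm_neg, norm_one, norm_pow, norm_real, one_div]
    exact (mul_le_of_le_one_right (by positivity) (hθ t ht)).trans
      (inv_sq_le (half_pos hc) (le_of_lt ht) (hball x hx t (le_of_lt ht)))
  · refine (ae_restrict_mem measurableSet_Ioi).mono fun t ht x hx => ?_
    have ht0 : 0 < t := ht
    have hne : x + (t : ℂ) ≠ 0 := norm_pos_iff.1
      (lt_of_lt_of_le (by positivity) (hball x hx t ht0.le))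
    have h1 : HasDerivAt (fun x : ℂ => 1 / (x + (t : ℂ))) (-1 / (x + (t : ℂ)) ^ 2) x := by
      have := ((hasDerivAt_id x).add_const (t : ℂ)).fun_inv hne
      simpa [one_div] using this
    exact (h1.sub_const _).mul_const _

/-- The Poisson integral of `θ` in the scale of the approximate identity `(1 + τ²)⁻¹`. -/
lemma im_thorinIntegral {θ : ℝ → ℝ} (hm : Measurable θ) (hθ : ∀ t, 0 < t → |θ t| ≤ 1) {z : ℂ}
    (hz : 0 < z.im) :
    (thorinIntegral θ z).im =
      -∫ τ : ℝ, (1 + τ ^ 2)⁻¹ * (Ioi 0).indicator θ (-z.re + z.im * τ) := by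
  have hzs : z ∈ slitPlane := Or.inr hz.ne'
  set f : ℝ → ℝ := fun t => z.im / ((z.re + t) ^ 2 + z.im ^ 2) * (Ioi 0).indicator θ t with hf
  have h1 : (thorinIntegral θ z).im = -∫ t, f t := by
    rw [thorinIntegral, ← imCLM_apply, ← imCLM.integral_comp_comm (integrableOn_thorin hm hθ hzs),
      ← integral_neg, ← integral_indicator measurableSet_Ioi]
    refine integral_congr_ae (ae_of_all _ fun t => ?_)
    by_cases ht : t ∈ Ioi (0 : ℝ)
    · simp only [hf, indicator_of_mem ht, imCLM_apply]
      have h2 : (1 / (1 + (t : ℂ))).im = 0 := by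
        rw [← ofReal_one, ← ofReal_add, ← ofReal_div, ofReal_im]
      have h3 : (1 / (z + (t : ℂ))).im = -(z.im / ((z.re + t) ^ 2 + z.im ^ 2)) := by
        rw [one_div, inv_im, normSq_apply]
        simp only [add_re, add_im, ofReal_re, ofReal_im, add_zero]
        ring
      rw [mul_comm, im_ofReal_mul, sub_im, h2, h3]
      ring
    · simp [hf, indicator_of_notMem ht]
  have h2 : ∫ t, f t = |z.im| • ∫ τ, f (-z.re + z.im * τ) := by
    rw [Measure.integral_comp_mul_left (fun t => f (-z.re + t)) z.im, smul_smul, abs_inv,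
      mul_inv_cancel₀ (abs_pos.2 hz.ne').ne', one_smul, integral_add_left_eq_self]
  rw [h1, h2, abs_of_pos hz, smul_eq_mul, ← integral_const_mul]
  congr 1
  refine integral_congr_ae (ae_of_all _ fun τ => ?_)
  simp only [hf]
  have : (z.re + (-z.re + z.im * τ)) ^ 2 + z.im ^ 2 = z.im ^ 2 * (1 + τ ^ 2) := by ring
  rw [this]
  have h3 : (1 + τ ^ 2) ≠ 0 := by positivity
  field_simp

lemma abs_indicator_le {θ : ℝ → ℝ} (hθ : ∀ t, 0 < t → |θ t| ≤ 1) (x : ℝ) :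
    |(Ioi 0).indicator θ x| ≤ 1 := by
  by_cases h : x ∈ Ioi (0 : ℝ)
  · rw [indicator_of_mem h]; exact hθ x h
  · rw [indicator_of_notMem h]; simp

lemma abs_im_thorinIntegral_le {θ : ℝ → ℝ} (hm : Measurable θ) (hθ : ∀ t, 0 < t → |θ t| ≤ 1)
    {z : ℂ} (hz : 0 < z.im) : |(thorinIntegral θ z).im| ≤ Real.pi := by
  rw [im_thorinIntegral hm hθ hz, abs_neg, ← Real.norm_eq_abs, ← integral_univ_inv_one_add_sq]
  refine norm_integral_le_of_norm_le integrable_inv_one_add_sq (ae_of_all _ fun τ => ?_)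
  rw [norm_mul, Real.norm_of_nonneg (by positivity)]
  exact mul_le_of_le_one_right (by positivity) (abs_indicator_le hθ _)

lemma tendsto_im_thorinIntegral {θ : ℝ → ℝ} (hm : Measurable θ) (hθ : ∀ t, 0 < t → |θ t| ≤ 1)
    {r : ℝ} (hr : 0 < r) (hc : ContinuousAt θ r) :
    Tendsto (fun z => (thorinIntegral θ z).im) (nhdsAbove r) (𝓝 (-(Real.pi * θ r))) := by
  have hind : Measurable ((Ioi (0 : ℝ)).indicator θ) := hm.indicator measurableSet_Ioi
  have hcind : ContinuousAt ((Ioi (0 : ℝ)).indicator θ) r := by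
    refine hc.congr ?_
    filter_upwards [lt_mem_nhds hr] with t ht
    rw [indicator_of_mem (show t ∈ Ioi (0 : ℝ) from ht)]
  have : (nhdsAbove r).IsCountablyGenerated := by unfold nhdsAbove; infer_instance
  have hlim : Tendsto (fun z : ℂ => ∫ τ : ℝ, (1 + τ ^ 2)⁻¹ *
      (Ioi 0).indicator θ (-z.re + z.im * τ)) (nhdsAbove r)
      (𝓝 (∫ τ : ℝ, (1 + τ ^ 2)⁻¹ * (Ioi 0).indicator θ r)) := by
    refine tendsto_integral_filter_of_dominated_convergence (fun τ => (1 + τ ^ 2)⁻¹)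
      (Eventually.of_forall fun z => ?_) (Eventually.of_forall fun z => ae_of_all _ fun τ => ?_)
      integrable_inv_one_add_sq (ae_of_all _ fun τ => ?_)
    · exact (Measurable.mul (by fun_prop) (hind.comp (by fun_prop))).aestronglyMeasurable
    · rw [norm_mul, Real.norm_of_nonneg (by positivity)]
      exact mul_le_of_le_one_right (by positivity) (abs_indicator_le hθ _)
    · refine Tendsto.const_mul _ (hcind.tendsto.comp ?_)
      have h1 : Continuous fun z : ℂ => -z.re + z.im * τ := by fun_prop
      exact (h1.tendsto' _ _ (by simp)).mono_left nhdsWithin_le_nhds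
  have h2 : ∫ τ : ℝ, (1 + τ ^ 2)⁻¹ * (Ioi 0).indicator θ r = Real.pi * θ r := by
    rw [integral_mul_const, integral_univ_inv_one_add_sq,
      indicator_of_mem (show r ∈ Ioi (0 : ℝ) from hr)]
  rw [h2] at hlim
  refine hlim.neg.congr' ?_
  filter_upwards [self_mem_nhdsWithin] with z hz
  exact (im_thorinIntegral hm hθ hz).symm

lemma im_thorinIntegral_ofReal (θ : ℝ → ℝ) (x : ℝ) : (thorinIntegral θ x).im = 0 := by
  have : thorinIntegral θ x =
      ((∫ t in Ioi (0 : ℝ), (1 / (x + t) - 1 / (1 + t)) * θ t : ℝ) : ℂ) := by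
    rw [← integral_complex_ofReal]
    simp [thorinIntegral]
  rw [this, ofReal_im]

/-! ### Boundary values and the representation -/

lemma log_neg_ofReal {r : ℝ} (hr : 0 < r) : log (-(r : ℂ)) = Real.log r + Real.pi * I := by
  rw [log, norm_neg, norm_real, Real.norm_of_nonneg hr.le, ← ofReal_neg,
    arg_ofReal_of_neg (by linarith)]

lemma neBot_nhdsAbove (r : ℝ) : (nhdsAbove r).NeBot := by
  refine mem_closure_iff_nhdsWithin_neBot.1 ?_
  rw [closure_setOfPred_lt_im]
  simp

lemma tendsto_G_nhdsAbove {α : ℝ} (hα : α ∈ Ioo (0 : ℝ) 1) {r : ℝ} (hr : 0 < r) :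
    Tendsto (G α) (nhdsAbove r) (𝓝 (logG α (Real.log r + Real.pi * I))) := by
  have h1 : Tendsto log (nhdsAbove r) (𝓝 (Real.log r + Real.pi * I)) := by
    rw [← log_neg_ofReal hr]
    exact (continuousWithinAt_log_of_re_neg_of_im_zero (by simpa using hr) (by simp)).mono_left
      (nhdsWithin_mono _ fun z (hz : 0 < z.im) => hz.le)
  refine (((differentiable_logG hα).continuous.tendsto _).comp h1).congr' ?_
  filter_upwards [self_mem_nhdsWithin] with z hz
  have hz0 : z ≠ 0 := by rintro rfl; simp at hz
  exact (G_eq_logG hα hz0).symm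

lemma GPlus_eq {α : ℝ} (hα : α ∈ Ioo (0 : ℝ) 1) {r : ℝ} (hr : 0 < r) :
    GPlus α r = logG α (Real.log r + Real.pi * I) := by
  have := neBot_nhdsAbove r
  exact (tendsto_G_nhdsAbove hα hr).limUnder_eq

lemma theta_eq {α : ℝ} (hα : α ∈ Ioo (0 : ℝ) 1) {r : ℝ} (hr : 0 < r) :
    theta α r = -(logK α (Real.log r + Real.pi * I)).arg / Real.pi := by
  rw [theta, GPlus_eq hα hr, logK_pi, arg_real_mul _ (Real.exp_pos _)]

/-- An everywhere defined measurable function which agrees with `theta α` on the positive axis. -/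
noncomputable def logTheta (α : ℝ) (r : ℝ) : ℝ :=
  -(logK α (Real.log r + Real.pi * I)).arg / Real.pi

lemma logTheta_mem {α : ℝ} (hα : α ∈ Ioo (0 : ℝ) 1) (r : ℝ) : logTheta α r ∈ Ioo (0 : ℝ) 1 := by
  have h := im_logK_pi_neg hα (Real.log r)
  have h1 : (logK α (Real.log r + Real.pi * I)).arg < 0 := arg_neg_iff.2 h
  have h2 := neg_pi_lt_arg (logK α (Real.log r + Real.pi * I))
  have hπ := Real.pi_pos
  constructor
  · exact div_pos (by linarith) hπ
  · rw [logTheta, div_lt_one hπ]; linarith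

lemma measurable_logTheta {α : ℝ} (hα : α ∈ Ioo (0 : ℝ) 1) : Measurable (logTheta α) := by
  have h1 : Measurable (logK α) := (differentiable_logK hα).continuous.measurable
  unfold logTheta
  have h2 : Measurable fun r : ℝ => (Real.log r : ℂ) + Real.pi * I :=
    (measurable_ofReal.comp Real.measurable_log).add_const _
  exact ((measurable_arg.comp (h1.comp h2)).neg).div_const _

lemma logK_pi_mem_slitPlane {α : ℝ} (hα : α ∈ Ioo (0 : ℝ) 1) (s : ℝ) :
    logK α (s + Real.pi * I) ∈ slitPlane := Or.inr (im_logK_pi_neg hα s).ne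

lemma continuousAt_logTheta {α : ℝ} (hα : α ∈ Ioo (0 : ℝ) 1) {r : ℝ} (hr : 0 < r) :
    ContinuousAt (logTheta α) r := by
  have h1 : ContinuousAt (fun r : ℝ => (Real.log r : ℂ) + Real.pi * I) r :=
    (continuous_ofReal.continuousAt.comp (Real.continuousAt_log hr.ne')).add_const _
  have h2 : ContinuousAt (fun r : ℝ => logK α ((Real.log r : ℂ) + Real.pi * I)) r :=
    ContinuousAt.comp (g := logK α) (differentiable_logK hα).continuous.continuousAt h1
  have h3 : ContinuousAt (fun r : ℝ => (logK α ((Real.log r : ℂ) + Real.pi * I)).arg) r :=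
    ContinuousAt.comp (f := fun r : ℝ => logK α ((Real.log r : ℂ) + Real.pi * I))
      (continuousAt_arg (logK_pi_mem_slitPlane hα _)) h2
  exact h3.neg.div_const _

lemma abs_logTheta_le {α : ℝ} (hα : α ∈ Ioo (0 : ℝ) 1) (t : ℝ) (_ : 0 < t) :
    |logTheta α t| ≤ 1 := by
  rw [abs_of_pos (logTheta_mem hα t).1]; exact (logTheta_mem hα t).2.le

lemma exp_mem_upper {w : ℂ} (hw : w ∈ strip) : 0 < (exp w).im := by
  rw [exp_im]
  exact mul_pos (Real.exp_pos _) (Real.sin_pos_of_pos_of_lt_pi hw.1 hw.2)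

/-- On the upper half-plane `log (e^{δz} G_α(z))` and the integral of `θ` differ by a real
constant: the imaginary part of their difference is bounded, and tends to zero at every finite
boundary point of the strip other than the two ends. -/
theorem exists_log_logK_eq {α : ℝ} (hα : α ∈ Ioo (0 : ℝ) 1) :
    ∃ c : ℝ, ∀ w ∈ strip, log (logK α w) = c + thorinIntegral (logTheta α) (exp w) := by
  have hm := measurable_logTheta hα
  have hθ := abs_logTheta_le hα
  have hπ := Real.pi_pos
  set D : ℂ → ℂ := fun w => log (logK α w) - thorinIntegral (logTheta α) (exp w) with hD
  have hslit : ∀ w ∈ strip, logK α w ∈ slitPlane := fun w hw => Or.inr (im_logK_neg hα hw).ne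
  have hDd : DifferentiableOn ℂ D strip := by
    refine DifferentiableOn.sub ?_ ?_
    · exact (differentiable_logK hα).differentiableOn.clog hslit
    · exact (differentiableOn_thorinIntegral hm hθ).comp differentiable_exp.differentiableOn
        fun w hw => Or.inr (exp_mem_upper hw).ne'
  have hbound : ∀ w ∈ strip, |(D w).im| ≤ 2 * Real.pi := by
    intro w hw
    have h1 := abs_im_thorinIntegral_le hm hθ (exp_mem_upper hw)
    have h2 : |(log (logK α w)).im| ≤ Real.pi := by rw [log_im]; exact abs_arg_le_pi _
    simp only [hD, sub_im]
    exact (abs_sub _ _).trans (by linarith)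
  have hlim : ∀ w₀ : ℂ, w₀.im = 0 ∨ w₀.im = Real.pi →
      Tendsto (fun w => (D w).im) (𝓝[strip] w₀) (𝓝 0) := by
    intro w₀ h
    rcases h with h | h
    · have hw₀ : w₀ = (w₀.re : ℂ) := by apply Complex.ext <;> simp [h]
      have hmem : logK α w₀ ∈ slitPlane := by rw [hw₀]; exact Or.inl (logK_re_pos hα _)
      have hexp : exp w₀ ∈ slitPlane := by
        rw [hw₀, ← ofReal_exp, ofReal_mem_slitPlane]; exact Real.exp_pos _
      have hc : ContinuousAt D w₀ := by
        refine ContinuousAt.sub ((differentiable_logK hα).continuous.continuousAt.clog hmem) ?_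
        exact ContinuousAt.comp (g := thorinIntegral (logTheta α))
          ((differentiableOn_thorinIntegral hm hθ).continuousOn.continuousAt
            (isOpen_slitPlane.mem_nhds hexp)) continuous_exp.continuousAt
      have h0 : (D w₀).im = 0 := by
        simp only [hD, sub_im, log_im]
        rw [hw₀, ← ofReal_exp, im_thorinIntegral_ofReal, sub_zero]
        exact arg_eq_zero_iff.2 ⟨(logK_re_pos hα _).le, logK_ofReal_im _⟩
      rw [← h0]
      exact ((continuous_im.continuousAt.comp hc).tendsto).mono_left nhdsWithin_le_nhds
    · have hw₀ : w₀ = (w₀.re : ℂ) + Real.pi * I := by apply Complex.ext <;> simp [h]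
      have hmem : logK α w₀ ∈ slitPlane := by rw [hw₀]; exact logK_pi_mem_slitPlane hα _
      have h1 : Tendsto (fun w => (log (logK α w)).im) (𝓝[strip] w₀) (𝓝 (logK α w₀).arg) := by
        have hc := (differentiable_logK hα).continuous.continuousAt.clog hmem
        rw [← log_im]
        exact ((continuous_im.continuousAt.comp hc).tendsto).mono_left nhdsWithin_le_nhds
      have h2 : Tendsto exp (𝓝[strip] w₀) (nhdsAbove (Real.exp w₀.re)) := by
        refine tendsto_nhdsWithin_iff.2 ⟨?_, ?_⟩
        · refine (continuous_exp.tendsto' _ _ ?_).mono_left nhdsWithin_le_nhds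
          rw [hw₀, exp_add_pi_mul_I]; simp
        · filter_upwards [self_mem_nhdsWithin] with w hw using exp_mem_upper hw
      have h3 := (tendsto_im_thorinIntegral hm hθ (Real.exp_pos w₀.re)
        (continuousAt_logTheta hα (Real.exp_pos _))).comp h2
      have h4 : -(Real.pi * logTheta α (Real.exp w₀.re)) = (logK α w₀).arg := by
        rw [logTheta, Real.log_exp, ← hw₀]
        field_simp
      rw [h4] at h3
      have h5 := h1.sub h3
      rw [sub_self] at h5
      exact h5.congr fun w => by simp [hD]
  have hle : ∀ σ : ℝ, |σ| = 1 → ∀ w ∈ strip, ‖exp (σ * I * D w)‖ ≤ 1 := by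
    intro σ hσ
    have hn : ∀ w, ‖exp (σ * I * D w)‖ = Real.exp (-σ * (D w).im) := by
      intro w
      rw [norm_exp, mul_assoc, re_ofReal_mul, I_mul_re]; ring_nf
    refine norm_le_one_of_strip (hDd.const_mul _).cexp (C := Real.exp (2 * Real.pi))
      (fun w hw => ?_) fun w₀ h η hη => ?_
    · rw [hn, Real.exp_le_exp]
      refine (le_abs_self _).trans ?_
      rw [abs_mul, abs_neg, hσ, one_mul]
      exact hbound w hw
    · have ht : Tendsto (fun w => Real.exp (-σ * (D w).im)) (𝓝[strip] w₀) (𝓝 1) := by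
        have := (Real.continuous_exp.tendsto _).comp ((hlim w₀ h).const_mul (-σ))
        simpa [Function.comp_def] using this
      filter_upwards [ht.eventually (gt_mem_nhds (by linarith : (1 : ℝ) < 1 + η))] with w hw
      rwa [hn]
  have him : ∀ w ∈ strip, (D w).im = 0 := by
    intro w hw
    have h1 := hle 1 (by simp) w hw
    have h2 := hle (-1) (by simp) w hw
    rw [norm_exp, Real.exp_le_one_iff] at h1 h2
    simp at h1 h2
    linarith
  obtain ⟨c, hc⟩ := (hDd.analyticOnNhd isOpen_strip).eq_const_add_im_mul_I_of_re_eq_const him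
    isOpen_strip ⟨⟨_, strip_nonempty⟩, convex_strip.isPreconnected⟩
  refine ⟨c, fun w hw => ?_⟩
  have := hc w hw
  simp only [hD, ofReal_zero, zero_mul, add_zero] at this
  linear_combination this

lemma differentiableOn_G {α : ℝ} (hα : α ∈ Ioo (0 : ℝ) 1) :
    DifferentiableOn ℂ (G α) slitPlane :=
  ((differentiable_logG hα).comp_differentiableOn
    (fun _ hz => (differentiableAt_log hz).differentiableWithinAt)).congr
    fun _ hz => G_eq_logG hα (slitPlane_ne_zero hz)

theorem exists_G_eq {α : ℝ} (hα : α ∈ Ioo (0 : ℝ) 1) :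
    ∃ a : ℝ, 0 < a ∧ ∀ z ∈ slitPlane,
      G α z = a * exp (-((delta α : ℂ) * z)) * exp (thorinIntegral (logTheta α) z) := by
  have hm := measurable_logTheta hα
  have hθ := abs_logTheta_le hα
  obtain ⟨c, hc⟩ := exists_log_logK_eq hα
  refine ⟨Real.exp c, Real.exp_pos c, ?_⟩
  have hupper : ∀ z : ℂ, 0 < z.im → G α z = (Real.exp c : ℂ) * exp (-((delta α : ℂ) * z)) *
      exp (thorinIntegral (logTheta α) z) := by
    intro z hz
    have hz0 : z ≠ 0 := by rintro rfl; simp at hz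
    have hw : log z ∈ strip := by
      constructor
      · rw [log_im]
        exact lt_of_le_of_ne (arg_nonneg_iff.2 hz.le) fun h =>
          hz.ne' (arg_eq_zero_iff.1 h.symm).2
      · rw [log_im]
        exact lt_of_le_of_ne (arg_le_pi z) fun h => hz.ne' (arg_eq_pi_iff.1 h).2
    have h1 := congrArg exp (hc _ hw)
    have hne : logK α (log z) ≠ 0 := by
      intro h; have := im_logK_neg hα hw; rw [h] at this; simp at this
    rw [exp_log hne, exp_add, logK, exp_log hz0, ← G_eq_logG hα hz0] at h1
    rw [ofReal_exp, exp_neg]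
    have hE := exp_ne_zero ((delta α : ℂ) * z)
    field_simp
    linear_combination h1
  have hI : (I : ℂ) ∈ slitPlane := by simp [slitPlane]
  have hR : DifferentiableOn ℂ (fun z => (Real.exp c : ℂ) * exp (-((delta α : ℂ) * z)) *
      exp (thorinIntegral (logTheta α) z)) slitPlane :=
    DifferentiableOn.mul (by fun_prop) (differentiableOn_thorinIntegral hm hθ).cexp
  have hG := (differentiableOn_G hα).analyticOnNhd isOpen_slitPlane
  refine hG.eqOn_of_preconnected_of_eventuallyEq
    (hR.analyticOnNhd isOpen_slitPlane)
    (starConvex_one_slitPlane.isPathConnected one_mem_slitPlane).isConnected.isPreconnected hI ?_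
  filter_upwards [(isOpen_lt continuous_const continuous_im).mem_nhds
    (show (0 : ℝ) < I.im by simp)] with z hz using hupper z hz

lemma thorinIntegrand_eq {α : ℝ} (hα : α ∈ Ioo (0 : ℝ) 1) (z : ℂ) :
    EqOn (fun t : ℝ => (1 / (z + (t : ℂ)) - 1 / (1 + (t : ℂ))) * (logTheta α t : ℂ))
      (fun t : ℝ => (1 / (z + (t : ℂ)) - 1 / (1 + (t : ℂ))) * (theta α t : ℂ)) (Ioi 0) := by
  intro t ht
  simp only []
  rw [theta_eq hα ht, logTheta]

end StableHCM

theorem mainTheorem3 (α : ℝ) (hα : α ∈ Set.Ioo (0 : ℝ) 1) :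
    (∀ r : ℝ, 0 < r →
      Tendsto (StableHCM.G α) (StableHCM.nhdsAbove r) (𝓝 (StableHCM.GPlus α r)) ∧
      StableHCM.theta α r ∈ Set.Ioo (0 : ℝ) 1 ∧
      ∃ R : ℝ, 0 < R ∧ StableHCM.GPlus α r =
        (R : ℂ) * Complex.exp (-(Complex.I * (Real.pi : ℂ) * (StableHCM.theta α r : ℂ)))) ∧
    ∃ a : ℝ, 0 < a ∧ ∀ z ∈ Complex.slitPlane,
      IntegrableOn
        (fun t : ℝ => (1 / (z + (t : ℂ)) - 1 / (1 + (t : ℂ))) * (StableHCM.theta α t : ℂ))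
        (Set.Ioi (0 : ℝ)) ∧
      StableHCM.G α z =
        (a : ℂ) * Complex.exp (-((StableHCM.delta α : ℂ) * z)) *
          Complex.exp (∫ t in Set.Ioi (0 : ℝ),
            (1 / (z + (t : ℂ)) - 1 / (1 + (t : ℂ))) * (StableHCM.theta α t : ℂ)) := by
  refine ⟨fun r hr => ⟨?_, ?_, ?_⟩, ?_⟩
  · rw [StableHCM.GPlus_eq hα hr]
    exact StableHCM.tendsto_G_nhdsAbove hα hr
  · rw [StableHCM.theta_eq hα hr]
    exact StableHCM.logTheta_mem hα r
  · have hne : StableHCM.GPlus α r ≠ 0 := by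
      rw [StableHCM.GPlus_eq hα hr]
      intro h
      have := StableHCM.im_logG_pi_neg hα (Real.log r)
      rw [h] at this
      simp at this
    refine ⟨‖StableHCM.GPlus α r‖, norm_pos_iff.2 hne, ?_⟩
    have hπ : (Real.pi : ℂ) ≠ 0 := Complex.ofReal_ne_zero.2 Real.pi_ne_zero
    have h : -(Complex.I * (Real.pi : ℂ) * (StableHCM.theta α r : ℂ)) =
        (StableHCM.GPlus α r).arg * Complex.I := by
      rw [StableHCM.theta]
      push_cast
      field_simp
    rw [h, Complex.norm_mul_exp_arg_mul_I]
  · obtain ⟨a, ha, hG⟩ := StableHCM.exists_G_eq hα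
    refine ⟨a, ha, fun z hz => ⟨?_, ?_⟩⟩
    · exact (StableHCM.integrableOn_thorin (StableHCM.measurable_logTheta hα)
        (StableHCM.abs_logTheta_le hα) hz).congr_fun (StableHCM.thorinIntegrand_eq hα z)
        measurableSet_Ioi
    · rw [hG z hz, StableHCM.thorinIntegral,
        setIntegral_congr_fun measurableSet_Ioi (StableHCM.thorinIntegrand_eq hα z)]
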